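/- **Setting.** Let $\mathcal L$ be a (strict) 2-category and $\mathcal S$ a class of morphisms of $\mathcal L$. Let $\mathcal L[\mathcal S^\dagger]$ be the 2-category obtained from $\mathcal L$ by freely adjoining a right adjoint $\nu^\dagger$ to each $\nu\in\mathcal S$, and $\mathcal L[\mathcal L^\dagger]$ the one obtained by doing so for all morphisms. In $\mathcal L[\mathcal S^\dagger]$ the *transparent* morphisms are those of $\mathcal L$, and the *sharp* morphisms (also called *tangible*) are those isomorphic to $\mu$ or to $\mu\circ\nu^\dagger$ with $\mu\in\mathcal L$ and $\nu\in\mathcal S$. A *natural pseudo-model* on a category $\mathscr D$ is a strict natural transformation $\tau:\mathrm{Tm}\to\mathrm{Ty}$ between groupoid-valued pseudofunctors on $\mathscr D^{\mathsf{op}}$ that has discrete fibers and is representable; so each $A\in\mathrm{Ty}(\Gamma)$ has a comprehension $\mathsf p_A:\Gamma\triangleright A\to\Gamma$. In it, a map $f:\Gamma\to\Delta$ is *anodyne* if for every $B\in\mathrm{Ty}(\Delta)$ and $g:\Gamma\to\Delta\triangleright B$ with $\mathsf p_B g=f$ there is $h:\Delta\to\Delta\triangleright B$ with $\mathsf p_Bh=1_\Delta$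 and $hf=g$; it is *stably anodyne* if every pullback of it is anodyne. An *adjoint modal pre-model* $(\widehat{\mathscr C},\mathscr C)$ over $(\mathcal L,\mathcal S)$ consists of: 1. a 2-functor $\widehat{\mathscr C}:\mathcal L[\mathcal L^\dagger]^{\mathsf{coop}}\to\mathcal{C}at$, with action $\widehat{\mathscr C}^\mu$ on morphisms, each $\widehat{\mathscr C}_p$ being locally cartesian closed with a terminal object (hence finite limits); write $\widehat{\mathscr C}_\mu=\widehat{\mathscr C}^{\mu^\dagger}$ for $\mu\in\mathcal L$; 2. a pseudofunctor $\mathscr C:\mathcal L[\mathcal S^\dagger]\to\mathcal{C}at$, with action $\mathscr C_\mu$ on morphisms, and a natural pseudo-model $\tau_p$ on each category $\mathscr C_p$; 3. a pseudonatural transformation $\mathsf L$ between the pseudofunctors $\mathcal L\to\mathcal{C}at$ given by $\mu\mapsto\widehat{\mathscr C}_\mu$ and $\mu\mapsto\mathscr C_\mu$, each component $\mathsf L_p:\widehat{\mathscr C}_p\to\mathscr C_p$ preserving finite limits and having a fully faithful right adjoint. $\mathscr C$ has *positive pre-modalities* if for every sharp $\mu:p\to q$ of $\mathcal L[\mathcal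 S^\dagger]$, $\Gamma\in\mathscr C_p$ and $A\in\mathrm{Ty}_p(\Gamma)$ there are a type $F^\flat_\mu A\in\mathrm{Ty}_q(\mathscr C_\mu\Gamma)$ and a map $i^\mu_{\Gamma,A}:\mathscr C_\mu(\Gamma\triangleright A)\to\mathscr C_\mu\Gamma\triangleright F^\flat_\mu A$ over $\mathscr C_\mu\Gamma$ such that $\mathscr C_\varrho(i^\mu_{\Gamma,A})$ is stably anodyne for every transparent $\varrho:q\to r$. Define $\widehat\tau^!_p:\widehat{\mathrm{Tm}}{}^!_p\to\widehat{\mathrm{Ty}}{}^!_p$, a morphism of presheaves on $\widehat{\mathscr C}_p$, as follows: an element of $\widehat{\mathrm{Ty}}{}^!_p(\Gamma)$ is an object $V\in\mathscr C_p$, a type $E\in\mathrm{Ty}_p(V)$ and a map $\mathsf L_p\Gamma\to V$; an element of $\widehat{\mathrm{Tm}}{}^!_p(\Gamma)$ is such $V$ and $E$ with a map $\mathsf L_p\Gamma\to V\triangleright E$; and $\widehat\tau^!_p$ composes with $\mathsf p_E$. **Theorem.** Let $(\widehat{\mathscr C},\mathscr C)$ be an adjoint modal pre-model over $(\mathcal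 L,\mathcal S)$ such that $\mathscr C$ has positive pre-modalities. Then $(\widehat{\mathscr C},\widehat\tau^!)$, restricted to $\mathcal L[\mathcal S^\dagger]$, is an adjoint modal natural model with positive modalities. That is, first, for every tangible $\mu:p\to q$ of $\mathcal L[\mathcal S^\dagger]$ the morphism of presheaves $(\widehat{\mathscr C}^\mu)^*\widehat\tau^!_p$ on $\widehat{\mathscr C}_q$ is representable. Second, for any choice of the resulting comprehensions $\Gamma\triangleright_\mu A\to\Gamma$ (for $A\in\widehat{\mathrm{Ty}}{}^!_p(\widehat{\mathscr C}^\mu\Gamma)$; write $\Gamma\triangleright B=\Gamma\triangleright_1B$) and every sharp $\mu:p\to q$, there are: * *(formation and introduction)* for all $\Gamma\in\widehat{\mathscr C}_q$ and $A\in\widehat{\mathrm{Ty}}{}^!_p(\widehat{\mathscr C}^\mu\Gamma)$, a type $F_\mu A\in\widehat{\mathrm{Ty}}{}^!_q(\Gamma)$ and a map $j_{\Gamma,A}:\Gamma\triangleright_\mu A\to\Gamma\triangleright F_\mu A$ over $\Gamma$, strictly natural in $\Gamma$; * *(elimination with transparent framing)* for every transparent $\varrho:q\to r$, $\Gamma\in\widehat{\mathscr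 C}_r$ and $A\in\widehat{\mathrm{Ty}}{}^!_p(\widehat{\mathscr C}^{\varrho\circ\mu}\Gamma)$, let $\ell:\Gamma\triangleright_{\varrho\circ\mu}A\to\Gamma\triangleright_\varrho F_\mu A$ be the map over $\Gamma$ that on terms is given by the map $(\widehat{\mathscr C}^\mu)^*\widehat{\mathrm{Tm}}{}^!_p\to\widehat{\mathrm{Tm}}{}^!_q$ corresponding to $j$, applied in context $\widehat{\mathscr C}^\varrho(-)$. Then for every $B\in\widehat{\mathrm{Ty}}{}^!_r(\Gamma\triangleright_\varrho F_\mu A)$ and every $g:\Gamma\triangleright_{\varrho\circ\mu}A\to(\Gamma\triangleright_\varrho F_\mu A)\triangleright B$ with $\mathsf p_Bg=\ell$ there is a chosen $h:\Gamma\triangleright_\varrho F_\mu A\to(\Gamma\triangleright_\varrho F_\mu A)\triangleright B$ with $\mathsf p_Bh=1$ and $h\ell=g$, these choices being strictly natural in $\Gamma$. -/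

import Mathlib

open CategoryTheory Bicategory Opposite Limits

namespace MATT

universe w v u

/-- A class of morphisms. -/
abbrev MorphismClass (L : Type u) [Bicategory.{w, v} L] := ∀ ⦃p q : L⦄, (p ⟶ q) → Prop

/-! ### Freely adjoining right adjoints to a class of morphisms of a strict 2-category -/

section FreeDagger

variable {L : Type u} [Bicategory.{w, v} L]

/-- The objects of the 2-category obtained from `L` by freely adjoining a right adjoint to every
morphism in `S`. -/
structure FreeDagger (S : MorphismClass L) where
  as : L

namespace FreeDagger

variable (S : MorphismClass L)

/-- Formal composites of morphisms of `L` and of formal right adjoints of morphisms in `S`. -/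
inductive Word : L → L → Type (max u v)
  | of {p q : L} (μ : p ⟶ q) : Word p q
  | dag {p q : L} (μ : p ⟶ q) (h : S μ) : Word q p
  | nil (p : L) : Word p p
  | comp {p q r : L} (x : Word p q) (y : Word q r) : Word p r

/-- The relations between formal composites: composition is associative and unital, and `of`
preserves identities and composites. -/
inductive WordRel : ∀ {p q : L}, Word S p q → Word S p q → Prop
  | of_id (p : L) : WordRel (.of (𝟙 p)) (.nil p)
  | of_comp {p q r : L} (μ : p ⟶ q) (ν : q ⟶ r) :
      WordRel (.of (μ ≫ ν)) (.comp (.of μ) (.of ν))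
  | id_comp {p q : L} (x : Word S p q) : WordRel (.comp (.nil p) x) x
  | comp_id {p q : L} (x : Word S p q) : WordRel (.comp x (.nil q)) x
  | assoc {p q r s : L} (x : Word S p q) (y : Word S q r) (z : Word S r s) :
      WordRel (.comp (.comp x y) z) (.comp x (.comp y z))
  | comp_left {p q r : L} (x : Word S p q) {y y' : Word S q r} :
      WordRel y y' → WordRel (.comp x y) (.comp x y')
  | comp_right {p q r : L} {x x' : Word S p q} (y : Word S q r) :
      WordRel x x' → WordRel (.comp x y) (.comp x' y)

instance : CategoryStruct.{max u v} (FreeDagger S) where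
  Hom a b := Quot (WordRel S (p := a.as) (q := b.as))
  id a := Quot.mk _ (.nil a.as)
  comp := Quot.map₂ Word.comp (fun x _ _ h => .comp_left x h) (fun _ _ y h => .comp_right y h)

variable {S}

/-- The image of a morphism of `L`. -/
def ofHom {p q : L} (μ : p ⟶ q) : (⟨p⟩ : FreeDagger S) ⟶ ⟨q⟩ := Quot.mk _ (.of μ)

/-- The freely added right adjoint of a morphism in `S`. -/
def dag {p q : L} (μ : p ⟶ q) (h : S μ) : (⟨q⟩ : FreeDagger S) ⟶ ⟨p⟩ := Quot.mk _ (.dag μ h)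

theorem ofHom_id (p : L) : (ofHom (𝟙 p) : (⟨p⟩ : FreeDagger S) ⟶ ⟨p⟩) = 𝟙 _ :=
  Quot.sound (.of_id p)

theorem ofHom_comp {p q r : L} (μ : p ⟶ q) (ν : q ⟶ r) :
    (ofHom (μ ≫ ν) : (⟨p⟩ : FreeDagger S) ⟶ ⟨r⟩) = ofHom μ ≫ ofHom ν :=
  Quot.sound (.of_comp μ ν)

theorem hom_id_comp {a b : FreeDagger S} (f : a ⟶ b) : 𝟙 a ≫ f = f := by
  induction f using Quot.ind with | mk x => exact Quot.sound (.id_comp x)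

theorem hom_comp_id {a b : FreeDagger S} (f : a ⟶ b) : f ≫ 𝟙 b = f := by
  induction f using Quot.ind with | mk x => exact Quot.sound (.comp_id x)

theorem hom_assoc {a b c d : FreeDagger S} (f : a ⟶ b) (g : b ⟶ c) (h : c ⟶ d) :
    (f ≫ g) ≫ h = f ≫ (g ≫ h) := by
  induction f using Quot.ind with | mk x =>
  induction g using Quot.ind with | mk y =>
  induction h using Quot.ind with | mk z => exact Quot.sound (.assoc x y z)

/-- Formal 2-cells: they are generated, under vertical composition and whiskering, by the 2-cells
of `L`, the units and counits of the added adjunctions, and equalities of morphisms. -/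
inductive Cell : ∀ {a b : FreeDagger S}, (a ⟶ b) → (a ⟶ b) → Type (max u v w)
  | of {p q : L} {μ ν : p ⟶ q} (α : μ ⟶ ν) : Cell (ofHom μ) (ofHom ν)
  | unit {p q : L} (μ : p ⟶ q) (h : S μ) : Cell (𝟙 (⟨p⟩ : FreeDagger S)) (ofHom μ ≫ dag μ h)
  | counit {p q : L} (μ : p ⟶ q) (h : S μ) : Cell (dag μ h ≫ ofHom μ) (𝟙 (⟨q⟩ : FreeDagger S))
  | ofEq {a b : FreeDagger S} {f g : a ⟶ b} (e : f = g) : Cell f g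
  | vcomp {a b : FreeDagger S} {f g h : a ⟶ b} (η : Cell f g) (θ : Cell g h) : Cell f h
  | whiskerLeft {a b c : FreeDagger S} (f : a ⟶ b) {g h : b ⟶ c} (η : Cell g h) :
      Cell (f ≫ g) (f ≫ h)
  | whiskerRight {a b c : FreeDagger S} {f g : a ⟶ b} (η : Cell f g) (h : b ⟶ c) :
      Cell (f ≫ h) (g ≫ h)

/-- The relations between formal 2-cells: the axioms of a strict 2-category, 2-functoriality of the
inclusion of `L`, and the triangle identities. -/
inductive CellRel : ∀ {a b : FreeDagger S} {f g : a ⟶ b}, Cell f g → Cell f g → Prop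
  | vcomp_left {a b : FreeDagger S} {f g h : a ⟶ b} (η : Cell f g) {θ θ' : Cell g h} :
      CellRel θ θ' → CellRel (.vcomp η θ) (.vcomp η θ')
  | vcomp_right {a b : FreeDagger S} {f g h : a ⟶ b} {η η' : Cell f g} (θ : Cell g h) :
      CellRel η η' → CellRel (.vcomp η θ) (.vcomp η' θ)
  | whiskerLeft_congr {a b c : FreeDagger S} (f : a ⟶ b) {g h : b ⟶ c} {η η' : Cell g h} :
      CellRel η η' → CellRel (.whiskerLeft f η) (.whiskerLeft f η')
  | whiskerRight_congr {a b c : FreeDagger S} {f g : a ⟶ b} {η η' : Cell f g} (h : b ⟶ c) :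
      CellRel η η' → CellRel (.whiskerRight η h) (.whiskerRight η' h)
  | id_vcomp {a b : FreeDagger S} {f g : a ⟶ b} (η : Cell f g) :
      CellRel (.vcomp (.ofEq rfl) η) η
  | vcomp_id {a b : FreeDagger S} {f g : a ⟶ b} (η : Cell f g) :
      CellRel (.vcomp η (.ofEq rfl)) η
  | vcomp_assoc {a b : FreeDagger S} {f g h i : a ⟶ b} (η : Cell f g) (θ : Cell g h)
      (ι : Cell h i) : CellRel (.vcomp (.vcomp η θ) ι) (.vcomp η (.vcomp θ ι))
  | whiskerLeft_id {a b c : FreeDagger S} (f : a ⟶ b) (g : b ⟶ c) :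
      CellRel (.whiskerLeft f (.ofEq (rfl : g = g))) (.ofEq rfl)
  | id_whiskerRight {a b c : FreeDagger S} (f : a ⟶ b) (g : b ⟶ c) :
      CellRel (.whiskerRight (.ofEq (rfl : f = f)) g) (.ofEq rfl)
  | whiskerLeft_vcomp {a b c : FreeDagger S} (f : a ⟶ b) {g h i : b ⟶ c} (η : Cell g h)
      (θ : Cell h i) :
      CellRel (.whiskerLeft f (.vcomp η θ)) (.vcomp (.whiskerLeft f η) (.whiskerLeft f θ))
  | vcomp_whiskerRight {a b c : FreeDagger S} {f g h : a ⟶ b} (η : Cell f g) (θ : Cell g h)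
      (i : b ⟶ c) :
      CellRel (.whiskerRight (.vcomp η θ) i) (.vcomp (.whiskerRight η i) (.whiskerRight θ i))
  | id_whiskerLeft {a b : FreeDagger S} {f g : a ⟶ b} (η : Cell f g) :
      CellRel (.whiskerLeft (𝟙 a) η)
        (.vcomp (.ofEq (hom_id_comp f)) (.vcomp η (.ofEq (hom_id_comp g).symm)))
  | comp_whiskerLeft {a b c d : FreeDagger S} (f : a ⟶ b) (g : b ⟶ c) {h h' : c ⟶ d}
      (η : Cell h h') :
      CellRel (.whiskerLeft (f ≫ g) η)
        (.vcomp (.ofEq (hom_assoc f g h)) (.vcomp (.whiskerLeft f (.whiskerLeft g η))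
          (.ofEq (hom_assoc f g h').symm)))
  | whiskerRight_id {a b : FreeDagger S} {f g : a ⟶ b} (η : Cell f g) :
      CellRel (.whiskerRight η (𝟙 b))
        (.vcomp (.ofEq (hom_comp_id f)) (.vcomp η (.ofEq (hom_comp_id g).symm)))
  | whiskerRight_comp {a b c d : FreeDagger S} {f f' : a ⟶ b} (η : Cell f f') (g : b ⟶ c)
      (h : c ⟶ d) :
      CellRel (.whiskerRight η (g ≫ h))
        (.vcomp (.ofEq (hom_assoc f g h).symm) (.vcomp (.whiskerRight (.whiskerRight η g) h)
          (.ofEq (hom_assoc f' g h))))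
  | whisker_assoc {a b c d : FreeDagger S} (f : a ⟶ b) {g g' : b ⟶ c} (η : Cell g g')
      (h : c ⟶ d) :
      CellRel (.whiskerRight (.whiskerLeft f η) h)
        (.vcomp (.ofEq (hom_assoc f g h)) (.vcomp (.whiskerLeft f (.whiskerRight η h))
          (.ofEq (hom_assoc f g' h).symm)))
  | whisker_exchange {a b c : FreeDagger S} {f g : a ⟶ b} {h i : b ⟶ c} (η : Cell f g)
      (θ : Cell h i) :
      CellRel (.vcomp (.whiskerLeft f θ) (.whiskerRight η i))
        (.vcomp (.whiskerRight η h) (.whiskerLeft g θ))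
  | of_id {p q : L} (μ : p ⟶ q) : CellRel (.of (𝟙 μ)) (.ofEq rfl)
  | of_vcomp {p q : L} {μ ν ρ : p ⟶ q} (α : μ ⟶ ν) (β : ν ⟶ ρ) :
      CellRel (.of (α ≫ β)) (.vcomp (.of α) (.of β))
  | of_whiskerLeft {p q r : L} (μ : p ⟶ q) {ν ρ : q ⟶ r} (β : ν ⟶ ρ) :
      CellRel (.of (μ ◁ β)) (.vcomp (.ofEq (ofHom_comp μ ν))
        (.vcomp (.whiskerLeft (ofHom μ) (.of β)) (.ofEq (ofHom_comp μ ρ).symm)))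
  | of_whiskerRight {p q r : L} {μ ν : p ⟶ q} (α : μ ⟶ ν) (ρ : q ⟶ r) :
      CellRel (.of (α ▷ ρ)) (.vcomp (.ofEq (ofHom_comp μ ρ))
        (.vcomp (.whiskerRight (.of α) (ofHom ρ)) (.ofEq (ofHom_comp ν ρ).symm)))
  | left_triangle {p q : L} (μ : p ⟶ q) (h : S μ) :
      CellRel (.vcomp (.whiskerRight (.unit μ h) (ofHom μ)) (.vcomp (.ofEq (hom_assoc _ _ _))
          (.whiskerLeft (ofHom μ) (.counit μ h))))
        (.ofEq ((hom_id_comp _).trans (hom_comp_id _).symm))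
  | right_triangle {p q : L} (μ : p ⟶ q) (h : S μ) :
      CellRel (.vcomp (.whiskerLeft (dag μ h) (.unit μ h))
          (.vcomp (.ofEq (hom_assoc _ _ _).symm) (.whiskerRight (.counit μ h) (dag μ h))))
        (.ofEq ((hom_comp_id _).trans (hom_id_comp _).symm))

instance homCategory (a b : FreeDagger S) : Category.{max u v w} (a ⟶ b) where
  Hom f g := Quot (CellRel (f := f) (g := g))
  id f := Quot.mk _ (.ofEq rfl)
  comp := Quot.map₂ Cell.vcomp (fun η _ _ h => .vcomp_left η h) (fun _ _ θ h => .vcomp_right θ h)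
  id_comp η := by
    induction η using Quot.ind with | mk x => exact Quot.sound (.id_vcomp x)
  comp_id η := by
    induction η using Quot.ind with | mk x => exact Quot.sound (.vcomp_id x)
  assoc η θ ι := by
    induction η using Quot.ind with | mk x =>
    induction θ using Quot.ind with | mk y =>
    induction ι using Quot.ind with | mk z => exact Quot.sound (.vcomp_assoc x y z)

theorem mk_ofEq {a b : FreeDagger S} {f g : a ⟶ b} (e : f = g) :
    (Quot.mk _ (Cell.ofEq e) : f ⟶ g) = eqToHom e := by
  cases e; rfl

instance bicategory : Bicategory.{max u v w, max u v} (FreeDagger S) where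
  homCategory := homCategory
  whiskerLeft f := Quot.map (Cell.whiskerLeft f) (fun _ _ h => .whiskerLeft_congr f h)
  whiskerRight η h := Quot.map (fun x => Cell.whiskerRight x h)
    (fun _ _ k => .whiskerRight_congr h k) η
  associator f g h := eqToIso (hom_assoc f g h)
  leftUnitor f := eqToIso (hom_id_comp f)
  rightUnitor f := eqToIso (hom_comp_id f)
  whiskerLeft_id f g := Quot.sound (.whiskerLeft_id f g)
  id_whiskerRight f g := Quot.sound (.id_whiskerRight f g)
  whiskerLeft_comp f _ _ _ η θ := by
    induction η using Quot.ind with | mk x =>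
    induction θ using Quot.ind with | mk y => exact Quot.sound (.whiskerLeft_vcomp f x y)
  comp_whiskerRight η θ i := by
    induction η using Quot.ind with | mk x =>
    induction θ using Quot.ind with | mk y => exact Quot.sound (.vcomp_whiskerRight x y i)
  id_whiskerLeft {_ _ f g} η := by
    induction η using Quot.ind with | mk x =>
    simp only [eqToIso.hom, eqToIso.inv, ← mk_ofEq]
    exact Quot.sound (.id_whiskerLeft x)
  comp_whiskerLeft f g _ _ η := by
    induction η using Quot.ind with | mk x =>
    simp only [eqToIso.hom, eqToIso.inv, ← mk_ofEq]
    exact Quot.sound (.comp_whiskerLeft f g x)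
  whiskerRight_id η := by
    induction η using Quot.ind with | mk x =>
    simp only [eqToIso.hom, eqToIso.inv, ← mk_ofEq]
    exact Quot.sound (.whiskerRight_id x)
  whiskerRight_comp η g h := by
    induction η using Quot.ind with | mk x =>
    simp only [eqToIso.hom, eqToIso.inv, ← mk_ofEq]
    exact Quot.sound (.whiskerRight_comp x g h)
  whisker_assoc f _ _ η h := by
    induction η using Quot.ind with | mk x =>
    simp only [eqToIso.hom, eqToIso.inv, ← mk_ofEq]
    exact Quot.sound (.whisker_assoc f x h)
  whisker_exchange η θ := by
    induction η using Quot.ind with | mk x =>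
    induction θ using Quot.ind with | mk y => exact Quot.sound (.whisker_exchange x y)
  pentagon f g h i := by
    have hL : ∀ {a b c : FreeDagger S} (f : a ⟶ b) {g h : b ⟶ c} (e : g = h),
        Quot.map (Cell.whiskerLeft f) (fun _ _ h => CellRel.whiskerLeft_congr f h) (eqToHom e) =
          (eqToHom (congrArg (f ≫ ·) e) : f ≫ g ⟶ f ≫ h) := by
      intro a b c f g h e; cases e; exact Quot.sound (.whiskerLeft_id f g)
    have hR : ∀ {a b c : FreeDagger S} {f g : a ⟶ b} (e : f = g) (h : b ⟶ c),
        Quot.map (fun x => Cell.whiskerRight x h)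
            (fun _ _ k => CellRel.whiskerRight_congr h k) (eqToHom e) =
          (eqToHom (congrArg (· ≫ h) e) : f ≫ h ⟶ g ≫ h) := by
      intro a b c f g e h; cases e; exact Quot.sound (.id_whiskerRight f h)
    simp only [eqToIso.hom, hL, hR, eqToHom_trans]
  triangle f g := by
    have hL : ∀ {a b c : FreeDagger S} (f : a ⟶ b) {g h : b ⟶ c} (e : g = h),
        Quot.map (Cell.whiskerLeft f) (fun _ _ h => CellRel.whiskerLeft_congr f h) (eqToHom e) =
          (eqToHom (congrArg (f ≫ ·) e) : f ≫ g ⟶ f ≫ h) := by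
      intro a b c f g h e; cases e; exact Quot.sound (.whiskerLeft_id f g)
    have hR : ∀ {a b c : FreeDagger S} {f g : a ⟶ b} (e : f = g) (h : b ⟶ c),
        Quot.map (fun x => Cell.whiskerRight x h)
            (fun _ _ k => CellRel.whiskerRight_congr h k) (eqToHom e) =
          (eqToHom (congrArg (· ≫ h) e) : f ≫ h ⟶ g ≫ h) := by
      intro a b c f g e h; cases e; exact Quot.sound (.id_whiskerRight f h)
    simp only [eqToIso.hom, hL, hR, eqToHom_trans]

instance strict : Bicategory.Strict (FreeDagger S) where
  id_comp := hom_id_comp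
  comp_id := hom_comp_id
  assoc := hom_assoc
  leftUnitor_eqToIso _ := rfl
  rightUnitor_eqToIso _ := rfl
  associator_eqToIso _ _ _ := rfl


/-- The inclusion 2-functor of `L`. -/
def incl [Bicategory.Strict L] (S : MorphismClass L) : StrictPseudofunctor L (FreeDagger S) :=
  .mk''
    { obj := fun p => ⟨p⟩
      map := fun μ => ofHom μ
      map₂ := fun α => Quot.mk _ (.of α)
      map₂_id := fun μ => Quot.sound (.of_id μ)
      map₂_comp := fun α β => Quot.sound (.of_vcomp α β)
      map_id := ofHom_id
      map_comp := ofHom_comp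
      map₂_whisker_left := fun μ _ _ β => by
        rw [← mk_ofEq, ← mk_ofEq]; exact Quot.sound (.of_whiskerLeft μ β)
      map₂_whisker_right := fun α ρ => by
        rw [← mk_ofEq, ← mk_ofEq]; exact Quot.sound (.of_whiskerRight α ρ) }

/-- The free adjunction between a morphism in `S` and its added right adjoint. -/
def dagAdj {p q : L} (μ : p ⟶ q) (h : S μ) :
    Bicategory.Adjunction (ofHom μ : (⟨p⟩ : FreeDagger S) ⟶ ⟨q⟩) (dag μ h) where
  unit := Quot.mk _ (.unit μ h)
  counit := Quot.mk _ (.counit μ h)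
  left_triangle := by
    have h₁ := Quot.sound (CellRel.left_triangle μ h)
    have h₂ : ∀ {a b : FreeDagger S} {f : a ⟶ b} {g : b ⟶ a} (η : 𝟙 a ⟶ f ≫ g)
        (ζ : g ≫ f ⟶ 𝟙 b), leftZigzag η ζ = η ▷ f ≫ (α_ f g f).hom ≫ f ◁ ζ := by
      intros; simp [leftZigzag, bicategoricalComp]
    rw [h₂, Bicategory.Strict.associator_eqToIso, Bicategory.Strict.leftUnitor_eqToIso,
      Bicategory.Strict.rightUnitor_eqToIso, eqToIso.hom, eqToIso.hom, eqToIso.inv, eqToHom_trans,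
      ← mk_ofEq, ← mk_ofEq]
    exact h₁
  right_triangle := by
    have h₁ := Quot.sound (CellRel.right_triangle μ h)
    have h₂ : ∀ {a b : FreeDagger S} {f : a ⟶ b} {g : b ⟶ a} (η : 𝟙 a ⟶ f ≫ g)
        (ζ : g ≫ f ⟶ 𝟙 b), rightZigzag η ζ = g ◁ η ≫ (α_ g f g).inv ≫ ζ ▷ g := by
      intros; simp [rightZigzag, bicategoricalComp]
    rw [h₂, Bicategory.Strict.associator_eqToIso, Bicategory.Strict.leftUnitor_eqToIso,
      Bicategory.Strict.rightUnitor_eqToIso, eqToIso.hom, eqToIso.inv, eqToIso.inv, eqToHom_trans,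
      ← mk_ofEq, ← mk_ofEq]
    exact h₁

section lift

universe w' v' u'

variable {B : Type u'} [Bicategory.{w', v'} B] [Bicategory.Strict L] [Bicategory.Strict B]
  (F : StrictPseudofunctor L B)
  (r : ∀ {p q : L} (μ : p ⟶ q), S μ → (F.obj q ⟶ F.obj p))
  (adj : ∀ {p q : L} (μ : p ⟶ q) (h : S μ), Bicategory.Adjunction (F.map μ) (r μ h))

/-- Evaluation of formal composites in a strict 2-category. -/
def Word.eval : ∀ {p q : L}, Word S p q → (F.obj p ⟶ F.obj q)
  | _, _, .of μ => F.map μ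
  | _, _, .dag μ h => r μ h
  | _, _, .nil p => 𝟙 (F.obj p)
  | _, _, .comp x y => x.eval ≫ y.eval

theorem WordRel.eval_eq {p q : L} {x y : Word S p q} (h : WordRel S x y) :
    x.eval F r = y.eval F r := by
  induction h with
  | of_id p => exact F.map_id p
  | of_comp μ ν => exact F.map_comp μ ν
  | id_comp x => exact Bicategory.Strict.id_comp _
  | comp_id x => exact Bicategory.Strict.comp_id _
  | assoc x y z => exact Bicategory.Strict.assoc _ _ _
  | comp_left x _ ih => exact congrArg (x.eval F r ≫ ·) ih
  | comp_right y _ ih => exact congrArg (· ≫ y.eval F r) ih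

/-- The action on morphisms of the 2-functor induced by a choice of right adjoints. -/
def evalHom {a b : FreeDagger S} : (a ⟶ b) → (F.obj a.as ⟶ F.obj b.as) :=
  Quot.lift (Word.eval F r) (fun _ _ h => h.eval_eq F r)

theorem evalHom_comp {a b c : FreeDagger S} (f : a ⟶ b) (g : b ⟶ c) :
    evalHom F r (f ≫ g) = evalHom F r f ≫ evalHom F r g := by
  induction f using Quot.ind with | mk x =>
  induction g using Quot.ind with | mk y => rfl

theorem evalHom_id (a : FreeDagger S) : evalHom F r (𝟙 a) = 𝟙 (F.obj a.as) := rfl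

/-- Evaluation of formal 2-cells in a strict 2-category. -/
def Cell.eval : ∀ {a b : FreeDagger S} {f g : a ⟶ b}, Cell f g →
    (evalHom F r f ⟶ evalHom F r g)
  | _, _, _, _, .of α => F.map₂ α
  | _, _, _, _, .unit μ h => (adj μ h).unit
  | _, _, _, _, .counit μ h => (adj μ h).counit
  | _, _, _, _, .ofEq e => eqToHom (congrArg _ e)
  | _, _, _, _, .vcomp η θ => η.eval ≫ θ.eval
  | _, _, _, _, .whiskerLeft f η => eqToHom (evalHom_comp F r _ _) ≫ evalHom F r f ◁ η.eval ≫
      eqToHom (evalHom_comp F r _ _).symm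
  | _, _, _, _, .whiskerRight η h => eqToHom (evalHom_comp F r _ _) ≫ η.eval ▷ evalHom F r h ≫
      eqToHom (evalHom_comp F r _ _).symm

theorem CellRel.eval_eq {a b : FreeDagger S} {f g : a ⟶ b} {x y : Cell f g} (h : CellRel x y) :
    x.eval F r adj = y.eval F r adj := by
  have e₁ : ∀ {a b c : B} {f f' : a ⟶ b} (e : f = f') {g h : b ⟶ c} (η : g ⟶ h),
      f ◁ η = eqToHom (by rw [e]) ≫ f' ◁ η ≫ eqToHom (by rw [e]) := by
    intro a b c f f' e g h η; cases e; simp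
  have e₂ : ∀ {a b c : B} {f f' : b ⟶ c} (e : f = f') {g h : a ⟶ b} (η : g ⟶ h),
      η ▷ f = eqToHom (by rw [e]) ≫ η ▷ f' ≫ eqToHom (by rw [e]) := by
    intro a b c f f' e g h η; cases e; simp
  induction h with
  | vcomp_left η _ ih => simp only [Cell.eval, ih]
  | vcomp_right θ _ ih => simp only [Cell.eval, ih]
  | whiskerLeft_congr f _ ih => simp only [Cell.eval, ih]
  | whiskerRight_congr h _ ih => simp only [Cell.eval, ih]
  | id_vcomp η => simp [Cell.eval]
  | vcomp_id η => simp [Cell.eval]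
  | vcomp_assoc η θ ι => simp [Cell.eval]
  | whiskerLeft_id f g => simp [Cell.eval]
  | id_whiskerRight f g => simp [Cell.eval]
  | whiskerLeft_vcomp f η θ => simp [Cell.eval]
  | vcomp_whiskerRight η θ i => simp [Cell.eval]
  | id_whiskerLeft η =>
    simp only [Cell.eval]
    rw [e₁ (evalHom_id F r _)]
    simp [Bicategory.Strict.leftUnitor_eqToIso]
  | comp_whiskerLeft f g η =>
    simp only [Cell.eval]
    rw [e₁ (evalHom_comp F r f g)]
    simp [Bicategory.Strict.associator_eqToIso]
  | whiskerRight_id η =>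
    simp only [Cell.eval]
    rw [e₂ (evalHom_id F r _)]
    simp [Bicategory.Strict.rightUnitor_eqToIso]
  | whiskerRight_comp η g h =>
    simp only [Cell.eval]
    rw [e₂ (evalHom_comp F r g h)]
    simp [Bicategory.Strict.associator_eqToIso]
  | whisker_assoc f η h =>
    simp [Cell.eval, Bicategory.Strict.associator_eqToIso]
  | whisker_exchange η θ =>
    simp [Cell.eval, whisker_exchange_assoc]
  | of_id μ => exact F.map₂_id μ
  | of_vcomp α β => exact F.map₂_comp α β
  | of_whiskerLeft μ β =>
    simp only [Cell.eval]
    rw [F.map₂_whisker_left, F.mapComp_eq_eqToIso, F.mapComp_eq_eqToIso]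
    simp only [← Category.assoc, eqToHom_trans]
    simp only [Category.assoc, eqToHom_trans]
    rfl
  | of_whiskerRight α ρ =>
    simp only [Cell.eval]
    rw [F.map₂_whisker_right, F.mapComp_eq_eqToIso, F.mapComp_eq_eqToIso]
    simp only [← Category.assoc, eqToHom_trans]
    simp only [Category.assoc, eqToHom_trans]
    rfl
  | left_triangle μ h =>
    have h₁ := (adj μ h).left_triangle
    have h₂ : ∀ {a b : B} {f : a ⟶ b} {g : b ⟶ a} (η : 𝟙 a ⟶ f ≫ g)
        (ζ : g ≫ f ⟶ 𝟙 b), leftZigzag η ζ = η ▷ f ≫ (α_ f g f).hom ≫ f ◁ ζ := by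
      intros; simp [leftZigzag, bicategoricalComp]
    rw [h₂, Bicategory.Strict.associator_eqToIso, Bicategory.Strict.leftUnitor_eqToIso,
      Bicategory.Strict.rightUnitor_eqToIso, eqToIso.hom, eqToIso.hom, eqToIso.inv,
      eqToHom_trans] at h₁
    simp only [Cell.eval, Category.assoc, eqToHom_trans_assoc]
    rw [eqToHom_comp_iff, ← Category.assoc, ← Category.assoc, comp_eqToHom_iff]
    simp only [Category.assoc, eqToHom_trans]
    exact h₁
  | right_triangle μ h =>
    have h₁ := (adj μ h).right_triangle
    have h₂ : ∀ {a b : B} {f : a ⟶ b} {g : b ⟶ a} (η : 𝟙 a ⟶ f ≫ g)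
        (ζ : g ≫ f ⟶ 𝟙 b), rightZigzag η ζ = g ◁ η ≫ (α_ g f g).inv ≫ ζ ▷ g := by
      intros; simp [rightZigzag, bicategoricalComp]
    rw [h₂, Bicategory.Strict.associator_eqToIso, Bicategory.Strict.leftUnitor_eqToIso,
      Bicategory.Strict.rightUnitor_eqToIso, eqToIso.hom, eqToIso.inv, eqToIso.inv,
      eqToHom_trans] at h₁
    simp only [Cell.eval, Category.assoc, eqToHom_trans_assoc]
    rw [eqToHom_comp_iff, ← Category.assoc, ← Category.assoc, comp_eqToHom_iff]
    simp only [Category.assoc, eqToHom_trans]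
    exact h₁

/-- The 2-functor out of `FreeDagger S` induced by a 2-functor out of `L` and a choice of right
adjoints of the images of the morphisms in `S`. -/
def lift : StrictPseudofunctor (FreeDagger S) B :=
  .mk''
    { obj := fun a => F.obj a.as
      map := evalHom F r
      map₂ := Quot.lift (Cell.eval F r adj) (fun _ _ h => h.eval_eq F r adj)
      map₂_id := fun _ => rfl
      map₂_comp := fun η θ => by
        induction η using Quot.ind with | mk x =>
        induction θ using Quot.ind with | mk y => rfl
      map_id := fun _ => rfl
      map_comp := evalHom_comp F r
      map₂_whisker_left := fun f _ _ η => by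
        induction η using Quot.ind with | mk x => rfl
      map₂_whisker_right := fun η h => by
        induction η using Quot.ind with | mk x => rfl }

end lift

/-- The canonical 2-functor from the 2-category with right adjoints added for the morphisms in `S`
to the one with right adjoints added for all morphisms. -/
def toAll [Bicategory.Strict L] (S : MorphismClass L) :
    StrictPseudofunctor (FreeDagger S) (FreeDagger fun (p q : L) (_ : p ⟶ q) => True) :=
  lift (incl _) (fun μ _ => dag μ trivial) (fun μ _ => dagAdj μ trivial)


end FreeDagger

end FreeDagger

/-! ### The dual of a bicategory with both 1-cells and 2-cells reversed -/

section Coop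

/-- The dual `B^coop` of a bicategory: both the 1-cells and the 2-cells are reversed. -/
structure Coop (B : Type u) where
  un : B

namespace Coop

variable {B : Type u} [Bicategory.{w, v} B]

/-- A 1-cell of `B^coop` is a 1-cell of `B` in the opposite direction. -/
@[ext]
structure Mor (a b : Coop B) where
  un : b.un ⟶ a.un

@[simps]
instance : CategoryStruct.{v} (Coop B) where
  Hom a b := Mor a b
  id a := ⟨𝟙 a.un⟩
  comp f g := ⟨g.un ≫ f.un⟩

/-- A 2-cell of `B^coop` is a 2-cell of `B` in the opposite direction. -/
@[ext]
structure TwoCell {a b : Coop B} (f g : a ⟶ b) where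
  un₂ : g.un ⟶ f.un

@[simps]
instance homCategory (a b : Coop B) : Category.{w} (a ⟶ b) where
  Hom f g := TwoCell f g
  id f := ⟨𝟙 f.un⟩
  comp η θ := ⟨θ.un₂ ≫ η.un₂⟩

@[ext]
theorem twoCell_ext {a b : Coop B} {f g : a ⟶ b} {η θ : f ⟶ g} (h : η.un₂ = θ.un₂) : η = θ :=
  TwoCell.ext h

/-- Isomorphisms of 1-cells of `B^coop`. -/
@[simps]
def iso₂Mk {a b : Coop B} {f g : a ⟶ b} (e : f.un ≅ g.un) : f ≅ g where
  hom := ⟨e.inv⟩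
  inv := ⟨e.hom⟩

@[simps! whiskerLeft_un₂ whiskerRight_un₂ associator_hom_un₂ associator_inv_un₂
  leftUnitor_hom_un₂ leftUnitor_inv_un₂ rightUnitor_hom_un₂ rightUnitor_inv_un₂]
instance bicategory : Bicategory.{w, v} (Coop B) where
  homCategory := homCategory
  whiskerLeft f _ _ η := ⟨η.un₂ ▷ f.un⟩
  whiskerRight η h := ⟨h.un ◁ η.un₂⟩
  associator f g h := iso₂Mk (α_ h.un g.un f.un).symm
  leftUnitor f := iso₂Mk (ρ_ f.un)
  rightUnitor f := iso₂Mk (λ_ f.un)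
  whisker_exchange η θ := by ext; exact whisker_exchange _ _

theorem eqToHom_un₂ {a b : Coop B} {f g : a ⟶ b} (e : f = g) :
    (eqToHom e : f ⟶ g).un₂ = eqToHom (congrArg Mor.un e.symm) := by
  cases e; rfl

instance strict [Bicategory.Strict B] : Bicategory.Strict (Coop B) where
  id_comp f := Mor.ext (Bicategory.Strict.comp_id f.un)
  comp_id f := Mor.ext (Bicategory.Strict.id_comp f.un)
  assoc f g h := Mor.ext (Bicategory.Strict.assoc h.un g.un f.un).symm
  leftUnitor_eqToIso f := by
    ext; simp [eqToHom_un₂, Bicategory.Strict.rightUnitor_eqToIso]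
  rightUnitor_eqToIso f := by
    ext; simp [eqToHom_un₂, Bicategory.Strict.leftUnitor_eqToIso]
  associator_eqToIso f g h := by
    ext; simp [eqToHom_un₂, Bicategory.Strict.associator_eqToIso]

/-- The 2-functor `F^coop`. -/
def map {C : Type*} [Bicategory C] [Bicategory.Strict B] [Bicategory.Strict C]
    (F : StrictPseudofunctor B C) : StrictPseudofunctor (Coop B) (Coop C) :=
  .mk''
    { obj := fun a => ⟨F.obj a.un⟩
      map := fun f => ⟨F.map f.un⟩
      map₂ := fun η => ⟨F.map₂ η.un₂⟩
      map_id := fun a => Mor.ext (F.map_id a.un)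
      map_comp := fun f g => Mor.ext (F.map_comp g.un f.un)
      map₂_whisker_left := fun f _ _ η => by
        ext; simp [eqToHom_un₂, F.map₂_whisker_right, F.mapComp_eq_eqToIso]
      map₂_whisker_right := fun η g => by
        ext; simp [eqToHom_un₂, F.map₂_whisker_left, F.mapComp_eq_eqToIso] }

/-- The pseudofunctor sending an adjunction to its right adjoint, and a pair of mates to the mate
between the right adjoints. -/
def rightAdjoint (B : Type u) [Bicategory.{w, v} B] : Pseudofunctor (Bicategory.Adj B) (Coop B) where
  obj a := ⟨a.obj⟩
  map f := ⟨f.r⟩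
  map₂ α := ⟨α.τr⟩
  mapId _ := Iso.refl _
  mapComp _ _ := Iso.refl _

end Coop

section dagger

variable {L : Type u} [Bicategory.{w, v} L] {B : Type*} [Bicategory B] (F : Pseudofunctor L B)
  (r : ∀ {p q : L} (_ : p ⟶ q), F.obj q ⟶ F.obj p)
  (adj : ∀ {p q : L} (μ : p ⟶ q), Bicategory.Adjunction (F.map μ) (r μ))

/-- A pseudofunctor together with a right adjoint of each `F.map μ` is a pseudofunctor to the
bicategory of adjunctions. -/
def toAdj : Pseudofunctor L (Bicategory.Adj B) where
  obj p := ⟨F.obj p⟩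
  map μ := ⟨adj μ⟩
  map₂ {_ _ μ ν} α := { τl := F.map₂ α, τr := conjugateEquiv (adj ν) (adj μ) (F.map₂ α) }
  mapId p := Bicategory.Adj.iso₂Mk (F.mapId p)
    (conjugateIsoEquiv (Bicategory.Adjunction.id _) (adj (𝟙 p)) (F.mapId p))
  mapComp μ ν := Bicategory.Adj.iso₂Mk (F.mapComp μ ν)
    (conjugateIsoEquiv ((adj μ).comp (adj ν)) (adj (μ ≫ ν)) (F.mapComp μ ν))

end dagger

end Coop

/-! ### Adjoint mode theories -/

/-- An adjoint mode theory on a strict 2-category `K`. -/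
structure AdjointModeTheory (K : Type u) [Bicategory.{w, v} K] [Bicategory.Strict K] where
  tangible : MorphismClass K
  sharp : MorphismClass K
  transparent : MorphismClass K
  sinister : MorphismClass K
  transparent_id (p : K) : transparent (𝟙 p)
  sharp_id (p : K) : sharp (𝟙 p)
  tangible_comp {p q r : K} {μ : p ⟶ q} {ν : q ⟶ r} :
    sharp μ → transparent ν → tangible (μ ≫ ν)
  sinister_isLeftAdjoint {p q : K} {μ : p ⟶ q} : sinister μ → Bicategory.IsLeftAdjoint μ

namespace AdjointModeTheory

variable {K : Type u} [Bicategory.{w, v} K] [Bicategory.Strict K] (M : AdjointModeTheory K)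

theorem tangible_of_sharp {p q : K} {μ : p ⟶ q} (h : M.sharp μ) : M.tangible μ := by
  have := M.tangible_comp h (M.transparent_id q)
  rwa [Bicategory.Strict.comp_id] at this

theorem tangible_of_transparent {p q : K} {μ : p ⟶ q} (h : M.transparent μ) : M.tangible μ := by
  have := M.tangible_comp (M.sharp_id p) h
  rwa [Bicategory.Strict.id_comp] at this

theorem tangible_id (p : K) : M.tangible (𝟙 p) := M.tangible_of_sharp (M.sharp_id p)

end AdjointModeTheory

namespace FreeDagger

variable {L : Type u} [Bicategory.{w, v} L] {S : MorphismClass L}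

/-- The morphisms isomorphic to one of the form `μ` or `μ ∘ ν†`, with `μ` in `L` and `ν` in `S`. -/
def IsSharp : MorphismClass (FreeDagger S) := fun a b f =>
  (∃ μ : a.as ⟶ b.as, Nonempty (f ≅ ofHom μ)) ∨
    ∃ (q : L) (ν : q ⟶ a.as) (h : S ν) (μ : q ⟶ b.as), Nonempty (f ≅ dag ν h ≫ ofHom μ)

/-- The adjoint mode theory on `FreeDagger S`: the transparent morphisms are those of `L`, the
sinister morphisms are those in `S`, and the tangible and the sharp morphisms are those isomorphic
to some `μ` or `μ ∘ ν†`, with `μ` in `L` and `ν` in `S`. -/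
def modeTheory (S : MorphismClass L) : AdjointModeTheory (FreeDagger S) where
  tangible := IsSharp
  sharp := IsSharp
  transparent := fun a b f => ∃ μ : a.as ⟶ b.as, f = ofHom μ
  sinister := fun a b f => ∃ μ : a.as ⟶ b.as, S μ ∧ f = ofHom μ
  transparent_id p := ⟨𝟙 p.as, (ofHom_id p.as).symm⟩
  sharp_id p := Or.inl ⟨𝟙 p.as, ⟨eqToIso (ofHom_id p.as).symm⟩⟩
  tangible_comp {p q r μ ν} hμ hν := by
    obtain ⟨ν, rfl⟩ := hν
    rcases hμ with ⟨μ, ⟨e⟩⟩ | ⟨s, ξ, h, μ, ⟨e⟩⟩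
    · exact Or.inl ⟨μ ≫ ν, ⟨whiskerRightIso e _ ≪≫ eqToIso (ofHom_comp μ ν).symm⟩⟩
    · exact Or.inr ⟨s, ξ, h, μ ≫ ν, ⟨whiskerRightIso e _ ≪≫
        eqToIso ((hom_assoc _ _ _).trans (congrArg (dag ξ h ≫ ·) (ofHom_comp μ ν).symm))⟩⟩
  sinister_isLeftAdjoint h := by
    obtain ⟨μ, hμ, rfl⟩ := h
    exact .mk (dagAdj μ hμ)

end FreeDagger

/-! ### Natural models -/

section NaturalModel

universe t v' u'

/-- A comprehension of `A ∈ Ty(Γ)`: an object `ext` with `p : ext ⟶ Γ` and a generic term `q` of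
type `A[p]`, exhibiting the presheaf of pairs of a `σ : Ξ ⟶ Γ` and a term of type `A[σ]` in context
`Ξ`, i.e. the pullback of `τ` along `A : y(Γ) ⟶ Ty`, as represented by `ext`. -/
structure Comprehension {𝒟 : Type u'} [Category.{v'} 𝒟] {Tm Ty : 𝒟ᵒᵖ ⥤ Type t} (τ : Tm ⟶ Ty)
    {Γ : 𝒟} (A : Ty.obj (op Γ)) where
  ext : 𝒟
  p : ext ⟶ Γ
  q : Tm.obj (op ext)
  q_type : τ.app (op ext) q = Ty.map p.op A
  isUniversal {Ξ : 𝒟} (σ : Ξ ⟶ Γ) (t : Tm.obj (op Ξ)) (h : τ.app (op Ξ) t = Ty.map σ.op A) :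
    ∃! f : Ξ ⟶ ext, f ≫ p = σ ∧ Tm.map f.op q = t

/-- Representability of a morphism of presheaves. -/
def Representable {𝒟 : Type u'} [Category.{v'} 𝒟] {Tm Ty : 𝒟ᵒᵖ ⥤ Type t} (τ : Tm ⟶ Ty) : Prop :=
  ∀ (Γ : 𝒟) (A : Ty.obj (op Γ)), Nonempty (Comprehension τ A)

namespace Comprehension

variable {𝒟 : Type u'} [Category.{v'} 𝒟] {Tm Ty : 𝒟ᵒᵖ ⥤ Type t} {τ : Tm ⟶ Ty} {Γ : 𝒟}
  {A : Ty.obj (op Γ)} (C : Comprehension τ A)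

/-- The morphism into a comprehension determined by `σ` and a term of type `A[σ]`. -/
noncomputable def lift {Ξ : 𝒟} (σ : Ξ ⟶ Γ) (t : Tm.obj (op Ξ))
    (h : τ.app (op Ξ) t = Ty.map σ.op A) : Ξ ⟶ C.ext :=
  (C.isUniversal σ t h).choose

theorem lift_p {Ξ : 𝒟} (σ : Ξ ⟶ Γ) (t : Tm.obj (op Ξ))
    (h : τ.app (op Ξ) t = Ty.map σ.op A) : C.lift σ t h ≫ C.p = σ :=
  (C.isUniversal σ t h).choose_spec.1.1

theorem lift_q {Ξ : 𝒟} (σ : Ξ ⟶ Γ) (t : Tm.obj (op Ξ))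
    (h : τ.app (op Ξ) t = Ty.map σ.op A) : Tm.map (C.lift σ t h).op C.q = t :=
  (C.isUniversal σ t h).choose_spec.1.2

/-- The morphism of comprehensions `Ξ ▷ A[σ] ⟶ Γ ▷ A` induced by `σ : Ξ ⟶ Γ`. -/
noncomputable def map {Ξ : 𝒟} {A' : Ty.obj (op Ξ)} (C' : Comprehension τ A')
    (C : Comprehension τ A) (σ : Ξ ⟶ Γ) (h : A' = Ty.map σ.op A) : C'.ext ⟶ C.ext :=
  C.lift (C'.p ≫ σ) C'.q (by
    subst h; rw [C'.q_type, op_comp, Functor.map_comp_apply])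

end Comprehension

/-- A modal context structure on `K`: a 2-functor `K^coop → Cat` whose values have terminal
objects. -/
structure ModalContextStructure (K : Type u) [Bicategory.{w, v} K] where
  functor : StrictPseudofunctor (Coop K) Cat.{v', u'}
  hasTerminal (p : K) : HasTerminal (functor.obj ⟨p⟩)

namespace ModalContextStructure

variable {K : Type u} [Bicategory.{w, v} K] (D : ModalContextStructure.{w, v, u, v', u'} K)

/-- The category of contexts at the mode `p`. -/
abbrev Ctx (p : K) : Type u' := D.functor.obj ⟨p⟩

/-- The functor `D^μ`. -/
abbrev lock {p q : K} (μ : p ⟶ q) : D.Ctx q ⥤ D.Ctx p :=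
  (D.functor.map (⟨μ⟩ : (⟨q⟩ : Coop K) ⟶ ⟨p⟩)).toFunctor

/-- The identification of `D^(1_p)` with the identity functor. -/
abbrev lockId (p : K) : D.lock (𝟙 p) ≅ 𝟭 (D.Ctx p) :=
  Cat.Hom.toNatIso (D.functor.mapId ⟨p⟩)

/-- The identification of `D^(ϱ ∘ μ)` with the composite of `D^ϱ` and `D^μ`. -/
abbrev lockComp {p q r : K} (μ : p ⟶ q) (ϱ : q ⟶ r) :
    D.lock (μ ≫ ϱ) ≅ D.lock ϱ ⋙ D.lock μ :=
  Cat.Hom.toNatIso (D.functor.mapComp (⟨ϱ⟩ : (⟨r⟩ : Coop K) ⟶ ⟨q⟩) ⟨μ⟩)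

end ModalContextStructure

/-- A morphism of presheaves `τ_p : Tm_p ⟶ Ty_p` on each category of a modal context structure. -/
structure TypeFamily {K : Type u} [Bicategory.{w, v} K]
    (D : ModalContextStructure.{w, v, u, v', u'} K) where
  Tm (p : K) : (D.Ctx p)ᵒᵖ ⥤ Type t
  Ty (p : K) : (D.Ctx p)ᵒᵖ ⥤ Type t
  τ (p : K) : Tm p ⟶ Ty p

namespace TypeFamily

variable {K : Type u} [Bicategory.{w, v} K]
  {D : ModalContextStructure.{w, v, u, v', u'} K} (T : TypeFamily.{w, v, u, t, v', u'} D)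

/-- The presheaf `(D^μ)^* Tm_p`. -/
abbrev TmL {p q : K} (μ : p ⟶ q) : (D.Ctx q)ᵒᵖ ⥤ Type t := (D.lock μ).op ⋙ T.Tm p

/-- The presheaf `(D^μ)^* Ty_p`. -/
abbrev TyL {p q : K} (μ : p ⟶ q) : (D.Ctx q)ᵒᵖ ⥤ Type t := (D.lock μ).op ⋙ T.Ty p

/-- The morphism of presheaves `(D^μ)^* τ_p`. -/
abbrev τL {p q : K} (μ : p ⟶ q) : T.TmL μ ⟶ T.TyL μ := Functor.whiskerLeft (D.lock μ).op (T.τ p)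

/-- The identification of `Ty_p(D^(ϱ ∘ μ) Γ)` with `Ty_p(D^μ (D^ϱ Γ))`. -/
def splitTy {p q r : K} (μ : p ⟶ q) (ϱ : q ⟶ r) {Γ : D.Ctx r}
    (A : (T.TyL (μ ≫ ϱ)).obj (op Γ)) : (T.TyL μ).obj (op ((D.lock ϱ).obj Γ)) :=
  (T.Ty p).map ((D.lockComp μ ϱ).inv.app Γ).op A

/-- The identification of `Tm_p(D^(ϱ ∘ μ) Γ)` with `Tm_p(D^μ (D^ϱ Γ))`. -/
def splitTm {p q r : K} (μ : p ⟶ q) (ϱ : q ⟶ r) {Γ : D.Ctx r}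
    (a : (T.TmL (μ ≫ ϱ)).obj (op Γ)) : (T.TmL μ).obj (op ((D.lock ϱ).obj Γ)) :=
  (T.Tm p).map ((D.lockComp μ ϱ).inv.app Γ).op a

theorem τL_splitTm {p q r : K} (μ : p ⟶ q) (ϱ : q ⟶ r) {Γ : D.Ctx r}
    (a : (T.TmL (μ ≫ ϱ)).obj (op Γ)) :
    (T.τL μ).app _ (T.splitTm μ ϱ a) = T.splitTy μ ϱ ((T.τL (μ ≫ ϱ)).app _ a) :=
  NatTrans.naturality_apply (T.τ p) ((D.lockComp μ ϱ).inv.app Γ).op a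

theorem splitTy_subst {p q r : K} (μ : p ⟶ q) (ϱ : q ⟶ r) {Ξ Γ : D.Ctx r} (σ : Ξ ⟶ Γ)
    (A : (T.TyL (μ ≫ ϱ)).obj (op Γ)) :
    T.splitTy μ ϱ ((T.TyL (μ ≫ ϱ)).map σ.op A) =
      (T.TyL μ).map ((D.lock ϱ).map σ).op (T.splitTy μ ϱ A) := by
  have h := (D.lockComp μ ϱ).inv.naturality σ
  have h' := congrArg (fun f => (T.Ty p).map f.op A) h
  simp only [op_comp, Functor.map_comp_apply] at h'
  exact h'.symm

variable [Bicategory.Strict K] (M : AdjointModeTheory K)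

/-- `D` with the morphisms `τ_p` is an adjoint modal natural model: `(D^μ)^* τ_p` is representable
for all tangible `μ`. -/
def IsAdjointModalNaturalModel : Prop :=
  ∀ ⦃p q : K⦄ (μ : p ⟶ q), M.tangible μ → Representable (T.τL μ)

/-- A choice of comprehensions `Γ ▷_μ A` for all tangible `μ`. -/
structure ComprehensionChoice where
  compr {p q : K} (μ : p ⟶ q) (h : M.tangible μ) {Γ : D.Ctx q} (A : (T.TyL μ).obj (op Γ)) :
    Comprehension (T.τL μ) A

namespace ComprehensionChoice

variable {T M} (c : T.ComprehensionChoice M)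

/-- The comprehension `Γ ▷ B`, which is `Γ ▷_1 B`, where `1` is an identity morphism. -/
def plain {p : K} {Γ : D.Ctx p} (B : (T.Ty p).obj (op Γ)) : Comprehension (T.τ p) B :=
  let C := c.compr (𝟙 p) (M.tangible_id p) ((T.Ty p).map ((D.lockId p).hom.app Γ).op B)
  { ext := C.ext
    p := C.p
    q := (T.Tm p).map ((D.lockId p).inv.app C.ext).op C.q
    q_type := by
      have h₁ := NatTrans.naturality_apply (T.τ p) ((D.lockId p).inv.app C.ext).op C.q
      have h₂ := C.q_type
      have h₃ : (D.lockId p).inv.app C.ext ≫ (D.lock (𝟙 p)).map C.p ≫ (D.lockId p).hom.app Γ =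
          C.p := by
        rw [(D.lockId p).hom.naturality C.p, Iso.inv_hom_id_app_assoc]; rfl
      have h₄ := congrArg (fun f => (T.Ty p).map f.op B) h₃
      simp only [op_comp, Functor.map_comp_apply] at h₄
      refine h₁.trans (Eq.trans ?_ h₄)
      exact congrArg _ h₂
    isUniversal := fun {Ξ} σ t h => by
      have key : ∀ f : Ξ ⟶ C.ext, (T.Tm p).map f.op ((T.Tm p).map
          ((D.lockId p).inv.app C.ext).op C.q) = t ↔
          (T.TmL (𝟙 p)).map f.op C.q = (T.Tm p).map ((D.lockId p).hom.app Ξ).op t := by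
        intro f
        have h₁ : (D.lockId p).inv.app Ξ ≫ (D.lock (𝟙 p)).map f = f ≫ (D.lockId p).inv.app C.ext :=
          ((D.lockId p).inv.naturality f).symm
        have h₂ := congrArg (fun f => (T.Tm p).map f.op C.q) h₁
        simp only [op_comp, Functor.map_comp_apply] at h₂
        have h₅ : ∀ x : (T.Tm p).obj (op Ξ), (T.Tm p).map ((D.lockId p).inv.app Ξ).op
            ((T.Tm p).map ((D.lockId p).hom.app Ξ).op x) = x := by
          intro x
          rw [← Functor.map_comp_apply, ← op_comp, Iso.inv_hom_id_app, op_id,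
            Functor.map_id_apply]
        have h₆ : ∀ x : (T.Tm p).obj (op ((D.lock (𝟙 p)).obj Ξ)),
            (T.Tm p).map ((D.lockId p).hom.app Ξ).op
              ((T.Tm p).map ((D.lockId p).inv.app Ξ).op x) = x := by
          intro x
          rw [← Functor.map_comp_apply, ← op_comp, Iso.hom_inv_id_app, op_id,
            Functor.map_id_apply]
        constructor
        · intro h
          rw [← h, ← h₂]
          exact (h₆ _).symm
        · intro h
          rw [← h₂]
          exact (congrArg _ h).trans (h₅ t)
      simp only [key]
      refine C.isUniversal σ _ ?_
      have h₁ := NatTrans.naturality_apply (T.τ p) ((D.lockId p).hom.app Ξ).op t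
      have h₂ := congrArg (fun f => (T.Ty p).map f.op B) ((D.lockId p).hom.naturality σ)
      simp only [op_comp, Functor.map_comp_apply] at h₂
      refine h₁.trans (Eq.trans ?_ h₂.symm)
      exact congrArg _ h }

end ComprehensionChoice

/-- The formation and introduction structure of a positive modality `F_μ`: types `F_μ A` and maps
`j : Γ ▷_μ A ⟶ Γ ▷ (F_μ A)` over `Γ`, strictly natural in `Γ`. -/
structure PositiveFormation (c : T.ComprehensionChoice M) {p q : K} (μ : p ⟶ q)
    (hμ : M.tangible μ) where
  F {Γ : D.Ctx q} (A : (T.TyL μ).obj (op Γ)) : (T.Ty q).obj (op Γ)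
  F_subst {Ξ Γ : D.Ctx q} (σ : Ξ ⟶ Γ) (A : (T.TyL μ).obj (op Γ)) :
    F ((T.TyL μ).map σ.op A) = (T.Ty q).map σ.op (F A)
  j {Γ : D.Ctx q} (A : (T.TyL μ).obj (op Γ)) : (c.compr μ hμ A).ext ⟶ (c.plain (F A)).ext
  j_p {Γ : D.Ctx q} (A : (T.TyL μ).obj (op Γ)) :
    j A ≫ (c.plain (F A)).p = (c.compr μ hμ A).p
  j_subst {Ξ Γ : D.Ctx q} (σ : Ξ ⟶ Γ) (A : (T.TyL μ).obj (op Γ)) :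
    j ((T.TyL μ).map σ.op A) ≫
        Comprehension.map (c.plain (F ((T.TyL μ).map σ.op A))) (c.plain (F A)) σ (F_subst σ A) =
      Comprehension.map (c.compr μ hμ ((T.TyL μ).map σ.op A)) (c.compr μ hμ A) σ rfl ≫ j A

namespace PositiveFormation

variable {T M} {c : T.ComprehensionChoice M} {p q : K} {μ : p ⟶ q} {hμ : M.tangible μ}
  (Φ : PositiveFormation T M c μ hμ)

/-- The introduction rule, i.e. the map of presheaves `(D^μ)^* Tm_p ⟶ Tm_q` determined by `j`:
a term `a` of type `A` in context `D^μ Γ` is sent to the term of type `F_μ A` in context `Γ`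
corresponding to the section of `Γ ▷ (F_μ A)` obtained by composing that of `Γ ▷_μ A` with `j`. -/
noncomputable def mod {Γ : D.Ctx q} (A : (T.TyL μ).obj (op Γ)) (a : (T.TmL μ).obj (op Γ))
    (ha : (T.τL μ).app (op Γ) a = A) : (T.Tm q).obj (op Γ) :=
  (T.Tm q).map ((c.compr μ hμ A).lift (𝟙 Γ) a
    (ha.trans (by rw [op_id, Functor.map_id_apply])) ≫ Φ.j A).op (c.plain (Φ.F A)).q

theorem τ_mod {Γ : D.Ctx q} (A : (T.TyL μ).obj (op Γ)) (a : (T.TmL μ).obj (op Γ))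
    (ha : (T.τL μ).app (op Γ) a = A) : (T.τ q).app (op Γ) (Φ.mod A a ha) = Φ.F A := by
  rw [mod, NatTrans.naturality_apply, (c.plain (Φ.F A)).q_type, ← Functor.map_comp_apply,
    ← op_comp, Category.assoc, Φ.j_p, Comprehension.lift_p, op_id, Functor.map_id_apply]

/-- The map `ℓ : Γ ▷_(ϱ ∘ μ) A ⟶ Γ ▷_ϱ (F_μ A)` over `Γ` whose generic term is the result of
applying the introduction rule to the generic term of `Γ ▷_(ϱ ∘ μ) A`. -/
noncomputable def ell {r : K} (ϱ : q ⟶ r) (hϱ : M.tangible ϱ) (hμϱ : M.tangible (μ ≫ ϱ))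
    {Γ : D.Ctx r} (A : (T.TyL (μ ≫ ϱ)).obj (op Γ)) :
    (c.compr (μ ≫ ϱ) hμϱ A).ext ⟶ (c.compr ϱ hϱ (Γ := Γ) (Φ.F (T.splitTy μ ϱ A))).ext :=
  let C := c.compr (μ ≫ ϱ) hμϱ A
  (c.compr ϱ hϱ (Γ := Γ) (Φ.F (T.splitTy μ ϱ A))).lift C.p
    (Φ.mod (T.splitTy μ ϱ ((T.TyL (μ ≫ ϱ)).map C.p.op A)) (T.splitTm μ ϱ C.q)
      ((T.τL_splitTm μ ϱ C.q).trans (congrArg _ C.q_type)))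
    ((Φ.τ_mod _ _ _).trans ((congrArg Φ.F (T.splitTy_subst μ ϱ C.p A)).trans
      (Φ.F_subst ((D.lock ϱ).map C.p) (T.splitTy μ ϱ A))))

theorem F_splitTy_subst {r : K} (ϱ : q ⟶ r) {Ξ Γ : D.Ctx r} (σ : Ξ ⟶ Γ)
    (A : (T.TyL (μ ≫ ϱ)).obj (op Γ)) :
    Φ.F (T.splitTy μ ϱ ((T.TyL (μ ≫ ϱ)).map σ.op A)) =
      (T.TyL ϱ).map σ.op (Φ.F (T.splitTy μ ϱ A)) :=
  (congrArg Φ.F (T.splitTy_subst μ ϱ σ A)).trans (Φ.F_subst ((D.lock ϱ).map σ) (T.splitTy μ ϱ A))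

end PositiveFormation

/-- The elimination structure of a positive modality with framing `ϱ`: chosen diagonal fillers in
the squares from `ℓ` to type projections, strictly natural in `Γ`. -/
structure PositiveElimination {c : T.ComprehensionChoice M} {p q : K} {μ : p ⟶ q}
    {hμ : M.tangible μ} (Φ : PositiveFormation T M c μ hμ) {r : K} (ϱ : q ⟶ r)
    (hϱ : M.tangible ϱ) (hμϱ : M.tangible (μ ≫ ϱ)) where
  elim {Γ : D.Ctx r} (A : (T.TyL (μ ≫ ϱ)).obj (op Γ))
    (B : (T.Ty r).obj (op (c.compr ϱ hϱ (Γ := Γ) (Φ.F (T.splitTy μ ϱ A))).ext))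
    (g : (c.compr (μ ≫ ϱ) hμϱ A).ext ⟶ (c.plain B).ext)
    (hg : g ≫ (c.plain B).p = Φ.ell ϱ hϱ hμϱ A) :
    (c.compr ϱ hϱ (Γ := Γ) (Φ.F (T.splitTy μ ϱ A))).ext ⟶ (c.plain B).ext
  elim_p {Γ : D.Ctx r} (A : (T.TyL (μ ≫ ϱ)).obj (op Γ))
    (B : (T.Ty r).obj (op (c.compr ϱ hϱ (Γ := Γ) (Φ.F (T.splitTy μ ϱ A))).ext))
    (g : (c.compr (μ ≫ ϱ) hμϱ A).ext ⟶ (c.plain B).ext)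
    (hg : g ≫ (c.plain B).p = Φ.ell ϱ hϱ hμϱ A) :
    elim A B g hg ≫ (c.plain B).p = 𝟙 _
  ell_elim {Γ : D.Ctx r} (A : (T.TyL (μ ≫ ϱ)).obj (op Γ))
    (B : (T.Ty r).obj (op (c.compr ϱ hϱ (Γ := Γ) (Φ.F (T.splitTy μ ϱ A))).ext))
    (g : (c.compr (μ ≫ ϱ) hμϱ A).ext ⟶ (c.plain B).ext)
    (hg : g ≫ (c.plain B).p = Φ.ell ϱ hϱ hμϱ A) :
    Φ.ell ϱ hϱ hμϱ A ≫ elim A B g hg = g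
  elim_subst {Ξ Γ : D.Ctx r} (σ : Ξ ⟶ Γ) (A : (T.TyL (μ ≫ ϱ)).obj (op Γ))
    (B : (T.Ty r).obj (op (c.compr ϱ hϱ (Γ := Γ) (Φ.F (T.splitTy μ ϱ A))).ext))
    (g : (c.compr (μ ≫ ϱ) hμϱ A).ext ⟶ (c.plain B).ext)
    (hg : g ≫ (c.plain B).p = Φ.ell ϱ hϱ hμϱ A) :
    let Aσ := (T.TyL (μ ≫ ϱ)).map σ.op A
    let m := Comprehension.map (c.compr ϱ hϱ (Γ := Ξ) (Φ.F (T.splitTy μ ϱ Aσ)))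
      (c.compr ϱ hϱ (Γ := Γ) (Φ.F (T.splitTy μ ϱ A))) σ (Φ.F_splitTy_subst ϱ σ A)
    let n := Comprehension.map (c.compr (μ ≫ ϱ) hμϱ Aσ) (c.compr (μ ≫ ϱ) hμϱ A) σ rfl
    let Bσ := (T.Ty r).map m.op B
    let k := Comprehension.map (c.plain Bσ) (c.plain B) m rfl
    ∀ (gσ : (c.compr (μ ≫ ϱ) hμϱ Aσ).ext ⟶ (c.plain Bσ).ext)
      (hgσ : gσ ≫ (c.plain Bσ).p = Φ.ell ϱ hϱ hμϱ Aσ), gσ ≫ k = n ≫ g →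
        elim Aσ Bσ gσ hgσ ≫ k = m ≫ elim A B g hg

/-- The positive modality `F_μ` of a sharp morphism `μ`, with elimination for all transparent
framings. -/
structure PositiveModality (c : T.ComprehensionChoice M) {p q : K} (μ : p ⟶ q)
    (hμ : M.sharp μ) where
  formation : PositiveFormation T M c μ (M.tangible_of_sharp hμ)
  elimination {r : K} (ϱ : q ⟶ r) (hϱ : M.transparent ϱ) :
    PositiveElimination T M formation ϱ (M.tangible_of_transparent hϱ) (M.tangible_comp hμ hϱ)

/-- An adjoint modal natural model with chosen comprehensions has positive modalities. -/
def HasPositiveModalities (c : T.ComprehensionChoice M) : Prop :=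
  ∀ ⦃p q : K⦄ (μ : p ⟶ q) (hμ : M.sharp μ), Nonempty (PositiveModality T M c μ hμ)

end TypeFamily

end NaturalModel

/-! ### Natural pseudo-models -/

section NaturalPseudoModel

universe t₁ t₂ v' u'

section

variable {C : Type u'} [Category.{v'} C]

/-- Substitution along `σ : Ξ ⟶ Γ` in a `Cat`-valued pseudofunctor on `Cᵒᵖ`. -/
abbrev psubst (T : Pseudofunctor (LocallyDiscrete Cᵒᵖ) Cat.{t₁, t₂}) {Ξ Γ : C} (σ : Ξ ⟶ Γ) :
    T.obj ⟨op Γ⟩ ⥤ T.obj ⟨op Ξ⟩ :=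
  (T.map σ.op.toLoc).toFunctor

/-- The coherence isomorphism between substitution along `f ≫ σ` and iterated substitution. -/
abbrev psubstComp (T : Pseudofunctor (LocallyDiscrete Cᵒᵖ) Cat.{t₁, t₂}) {Θ Ξ Γ : C}
    (f : Θ ⟶ Ξ) (σ : Ξ ⟶ Γ) : psubst T (f ≫ σ) ≅ psubst T σ ⋙ psubst T f :=
  Cat.Hom.toNatIso (T.mapComp σ.op.toLoc f.op.toLoc)

variable {Tm Ty : Pseudofunctor (LocallyDiscrete Cᵒᵖ) Cat.{t₁, t₂}}
  (τ : Pseudofunctor.StrongTrans Tm Ty)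

/-- The component `Tm(Γ) ⥤ Ty(Γ)`. -/
abbrev pcomp (Γ : C) : Tm.obj ⟨op Γ⟩ ⥤ Ty.obj ⟨op Γ⟩ := (τ.app ⟨op Γ⟩).toFunctor

/-- The naturality isomorphism of `τ` at `f : Ξ ⟶ Γ`. -/
abbrev pnat {Ξ Γ : C} (f : Ξ ⟶ Γ) : psubst Tm f ⋙ pcomp τ Ξ ≅ pcomp τ Γ ⋙ psubst Ty f :=
  Cat.Hom.toNatIso (τ.naturality f.op.toLoc)

/-- A comprehension of `A ∈ Ty(Γ)`: an object `ext` with `p : ext ⟶ Γ` and a generic term `q` of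
type `A[p]`, exhibiting the pullback of `τ` along `A : y(Γ) ⟶ Ty` as represented by `ext`. -/
structure PseudoComprehension {Γ : C} (A : Ty.obj ⟨op Γ⟩) where
  ext : C
  p : ext ⟶ Γ
  q : Tm.obj ⟨op ext⟩
  q_type : (pcomp τ ext).obj q ≅ (psubst Ty p).obj A
  isUniversal {Ξ : C} (σ : Ξ ⟶ Γ) (t : Tm.obj ⟨op Ξ⟩)
    (ψ : (pcomp τ Ξ).obj t ≅ (psubst Ty σ).obj A) :
    ∃! f : Ξ ⟶ ext, ∃ (e : f ≫ p = σ) (θ : t ≅ (psubst Tm f).obj q),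
      ψ.hom = (pcomp τ Ξ).map θ.hom ≫ (pnat τ f).hom.app q ≫ (psubst Ty f).map q_type.hom ≫
        (psubstComp Ty f p).inv.app A ≫ eqToHom (by rw [e])

end

/-- A natural pseudo-model on `C`: a strict natural transformation `τ : Tm ⟶ Ty` of
groupoid-valued pseudofunctors on `Cᵒᵖ` with discrete fibers (each component is a discrete
fibration) and with comprehensions. -/
structure NaturalPseudoModel (C : Type u') [Category.{v'} C] where
  Tm : Pseudofunctor (LocallyDiscrete Cᵒᵖ) Cat.{t₁, t₂}
  Ty : Pseudofunctor (LocallyDiscrete Cᵒᵖ) Cat.{t₁, t₂}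
  isGroupoid_Tm (Γ : C) : IsGroupoid (Tm.obj ⟨op Γ⟩)
  isGroupoid_Ty (Γ : C) : IsGroupoid (Ty.obj ⟨op Γ⟩)
  τ : Pseudofunctor.StrongTrans Tm Ty
  isStrict {Ξ Γ : C} (f : Ξ ⟶ Γ) :
    ∃ e : Tm.map f.op.toLoc ≫ τ.app ⟨op Ξ⟩ = τ.app ⟨op Γ⟩ ≫ Ty.map f.op.toLoc,
      τ.naturality f.op.toLoc = eqToIso e
  isDiscrete {Γ : C} (t : Tm.obj ⟨op Γ⟩) (A : Ty.obj ⟨op Γ⟩) (f : A ⟶ (pcomp τ Γ).obj t) :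
    ∃! x : Over t, ∃ e : (pcomp τ Γ).obj x.left = A, (pcomp τ Γ).map x.hom = eqToHom e ≫ f
  compr {Γ : C} (A : Ty.obj ⟨op Γ⟩) : PseudoComprehension τ A

namespace NaturalPseudoModel

variable {C : Type u'} [Category.{v'} C] (N : NaturalPseudoModel.{t₁, t₂, v', u'} C)

/-- `f` is anodyne: every square from `f` to a type projection `p_B` over its codomain has a
diagonal filler. -/
def Anodyne {Γ Ξ : C} (f : Γ ⟶ Ξ) : Prop :=
  ∀ (B : N.Ty.obj ⟨op Ξ⟩) (g : Γ ⟶ (N.compr B).ext), g ≫ (N.compr B).p = f →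
    ∃ h : Ξ ⟶ (N.compr B).ext, h ≫ (N.compr B).p = 𝟙 Ξ ∧ f ≫ h = g

/-- `f` is stably anodyne: every pullback of `f` is anodyne. -/
def StablyAnodyne {Γ Ξ : C} (f : Γ ⟶ Ξ) : Prop :=
  ∀ ⦃Γ' Ξ' : C⦄ (a : Γ' ⟶ Γ) (f' : Γ' ⟶ Ξ') (b : Ξ' ⟶ Ξ), IsPullback a f' f b → N.Anodyne f'

/-- A type of the left adjoint splitting in context `Γ`: a local universe `base`, a type over it,
and a morphism `name : Γ ⟶ base`. -/
structure SplitTy (Γ : C) where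
  base : C
  type : N.Ty.obj ⟨op base⟩
  name : Γ ⟶ base

/-- A term of the left adjoint splitting in context `Γ`. -/
structure SplitTm (Γ : C) where
  base : C
  type : N.Ty.obj ⟨op base⟩
  term : Γ ⟶ (N.compr type).ext

/-- The presheaf `Ty^!`. -/
def splitTy : Cᵒᵖ ⥤ Type (max u' v' t₂) where
  obj Γ := N.SplitTy Γ.unop
  map σ := ↾fun A => ⟨A.base, A.type, σ.unop ≫ A.name⟩

/-- The presheaf `Tm^!`. -/
def splitTm : Cᵒᵖ ⥤ Type (max u' v' t₂) where
  obj Γ := N.SplitTm Γ.unop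
  map σ := ↾fun a => ⟨a.base, a.type, σ.unop ≫ a.term⟩

/-- The left adjoint splitting `τ^! : Tm^! ⟶ Ty^!`. -/
def splitτ : N.splitTm ⟶ N.splitTy where
  app Γ := ↾fun a => ⟨a.base, a.type, a.term ≫ (N.compr a.type).p⟩
  naturality X Y f := by
    ext a
    exact congrArg (SplitTy.mk a.base a.type) (Category.assoc f.unop a.term (N.compr a.type).p)

end NaturalPseudoModel

/-- A modal pre-model over `K`: a pseudofunctor `K → Cat` whose values are natural
pseudo-models. -/
structure ModalPreModel (K : Type u) [Bicategory.{w, v} K] where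
  functor : Pseudofunctor K Cat.{v', u'}
  model (p : K) : NaturalPseudoModel.{t₁, t₂} (functor.obj p)

namespace ModalPreModel

variable {K : Type u} [Bicategory.{w, v} K] [Bicategory.Strict K]

/-- The modal pre-model has positive pre-modalities. -/
def HasPositivePreModalities (P : ModalPreModel.{w, v, u, t₁, t₂, v', u'} K)
    (M : AdjointModeTheory K) : Prop :=
  ∀ ⦃p q : K⦄ (μ : p ⟶ q), M.sharp μ → ∀ (Γ : P.functor.obj p) (A : (P.model p).Ty.obj ⟨op Γ⟩),
    ∃ (FA : (P.model q).Ty.obj ⟨op ((P.functor.map μ).toFunctor.obj Γ)⟩)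
      (i : (P.functor.map μ).toFunctor.obj ((P.model p).compr A).ext ⟶
        ((P.model q).compr FA).ext),
      i ≫ ((P.model q).compr FA).p = (P.functor.map μ).toFunctor.map ((P.model p).compr A).p ∧
      ∀ ⦃r : K⦄ (ϱ : q ⟶ r), M.transparent ϱ →
        (P.model r).StablyAnodyne ((P.functor.map ϱ).toFunctor.map i)

end ModalPreModel

end NaturalPseudoModel

/-! ### Adjoint modal pre-models -/

section AdjointModalPreModel

universe t₁ t₂ v' u'

/-- A category is locally cartesian closed: it has finite limits and all pullback functors between
its slices have right adjoints. -/
structure IsLocallyCartesianClosed (C : Type u') [Category.{v'} C] : Prop where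
  hasFiniteLimits : HasFiniteLimits C
  isLeftAdjoint {X Y : C} (f : X ⟶ Y) : (Over.pullback f).IsLeftAdjoint

variable {L : Type u} [Bicategory.{w, v} L] [Bicategory.Strict L]

/-- The 2-category obtained from `L` by freely adjoining right adjoints to all morphisms. -/
abbrev FreeDaggerAll (L : Type u) [Bicategory.{w, v} L] :=
  FreeDagger fun (p q : L) (_ : p ⟶ q) => True

/-- The pseudofunctor from `L` sending each `μ` to its added right adjoint `μ†`, and a 2-cell to
its mate. -/
def daggers (L : Type u) [Bicategory.{w, v} L] [Bicategory.Strict L] :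
    Pseudofunctor L (Coop (FreeDaggerAll L)) :=
  (toAdj (FreeDagger.incl (L := L) fun _ _ _ => True).toPseudofunctor
    (fun μ => FreeDagger.dag μ trivial) (fun μ => FreeDagger.dagAdj μ trivial)).comp
    (Coop.rightAdjoint _)

/-- An adjoint modal pre-model over `(L, S)`. -/
structure AdjointModalPreModel (S : MorphismClass L) where
  hat : ModalContextStructure.{_, _, _, v', u'} (FreeDaggerAll L)
  isLocallyCartesianClosed (p : FreeDaggerAll L) : IsLocallyCartesianClosed (hat.Ctx p)
  preModel : ModalPreModel.{_, _, _, t₁, t₂, v', u'} (FreeDagger S)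
  refl : Pseudofunctor.StrongTrans ((daggers L).comp hat.functor.toPseudofunctor)
    ((FreeDagger.incl S).toPseudofunctor.comp preModel.functor)
  preservesFiniteLimits (p : L) : PreservesFiniteLimits (refl.app p).toFunctor
  incl (p : L) : preModel.functor.obj ⟨p⟩ ⥤ hat.Ctx ⟨p⟩
  adj (p : L) : CategoryTheory.Adjunction (refl.app p).toFunctor (incl p)
  full_incl (p : L) : (incl p).Full
  faithful_incl (p : L) : (incl p).Faithful

namespace AdjointModalPreModel

variable {S : MorphismClass L} (P : AdjointModalPreModel.{w, v, u, t₁, t₂, v', u'} S)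

/-- The restriction of the modal context structure along the canonical 2-functor from
`FreeDagger S`. -/
def context : ModalContextStructure.{_, _, _, v', u'} (FreeDagger S) where
  functor := (Coop.map (FreeDagger.toAll S)).comp P.hat.functor
  hasTerminal p := P.hat.hasTerminal ⟨p.as⟩

/-- The reflector from the category of contexts at the mode `p`. -/
abbrev reflector (p : FreeDagger S) : P.context.Ctx p ⥤ P.preModel.functor.obj p :=
  (P.refl.app p.as).toFunctor

/-- The pullback along the reflectors of the left adjoint splittings. -/
def splitting : TypeFamily P.context where
  Tm p := (P.reflector p).op ⋙ (P.preModel.model p).splitTm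
  Ty p := (P.reflector p).op ⋙ (P.preModel.model p).splitTy
  τ p := Functor.whiskerLeft (P.reflector p).op (P.preModel.model p).splitτ

end AdjointModalPreModel

end AdjointModalPreModel

end MATT

universe t₁ t₂ v' u' w v u

namespace MATT

/-! ### Comprehensions -/

namespace Comprehension

universe t

variable {𝒟 : Type u'} [Category.{v'} 𝒟] {Tm Ty : 𝒟ᵒᵖ ⥤ Type t} {τ : Tm ⟶ Ty}

/-! Write L for the reflectors, C for the pre-model, D for the context structure and G for the
composite of D^μ with L_p. A type of the splitting over μ in context Γ is a triple (V, E, n : GΓ ⟶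
V), and a term of it is a lift of n to V ▷ E. So if G has a right adjoint R, the comprehension is
the pullback of R(p_E) along the transpose of n.

For sharp μ such an R exists (`nonempty_pushLift`). If μ = ϱ lies in the base 2-category, D^ϱ has
the right adjoint D^(ϱ†), and L has its fully faithful one. If μ = ν†, pseudonaturality identifies L
∘ D^(ν†) with C_ν ∘ L, whose right adjoint is C_(ν†) followed by the inclusion. In all cases L_q ∘ R
≅ C_μ, and this isomorphism is carried along in `RightAdjointOver`. It yields a comparison map u :
L_q ⟶ C_μ ∘ G.

Formation sends (V, E, n) to (C_μ V, F♭E, u_Γ ≫ C_μ n), and introduction composes in the same way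
with i. Substitution changes only the name, so both are strictly natural once F♭ and i have been
chosen for each pair (V, E).

For elimination, L preserves finite limits, so L_q(Γ ▷_μ A) is a pullback of C_μ(p_E)
(`NaturalPseudoModel.isPullback_unit`). Using this for ϱ ∘ μ and for ϱ, cancellation of pullbacks
shows that L_r(ℓ) is a pullback of C_ϱ(i) (`PrePositive.isPullback_ell`). Stable anodyneness then
fills squares from L_r(ℓ) to any type projection (`StablyAnodyne.exists_filler`), and such a filler
is the same thing as a section of the comprehension of B.

Anodyneness gives only existence, whereas the fillers must be strictly natural. For fixed (V, E) and
(V', E'), which substitution does not change, the lifting problems have a universal instance; it is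
filled once and the filler restricted to all others (`exists_natural_fillers`). The universal
instance exists because source and target of L_r(ℓ) are left adjoint functors of the context with
its name: such contexts form a slice, over which the comprehensions are pulled back from a single
one, and pullback functors have right adjoints by local cartesian closure. -/

theorem hom_ext {Γ : 𝒟} {A : Ty.obj (op Γ)} (C : Comprehension τ A) {Ξ : 𝒟} {f g : Ξ ⟶ C.ext}
    (hp : f ≫ C.p = g ≫ C.p) (hq : Tm.map f.op C.q = Tm.map g.op C.q) : f = g := by
  refine (C.isUniversal (g ≫ C.p) (Tm.map g.op C.q) ?_).unique ⟨hp, hq⟩ ⟨rfl, rfl⟩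
  rw [NatTrans.naturality_apply, C.q_type, op_comp, Functor.map_comp_apply]

theorem map_p {Ξ Γ : 𝒟} {A' : Ty.obj (op Ξ)} {A : Ty.obj (op Γ)} (C' : Comprehension τ A')
    (C : Comprehension τ A) (σ : Ξ ⟶ Γ) (h : A' = Ty.map σ.op A) :
    C'.map C σ h ≫ C.p = C'.p ≫ σ :=
  lift_p _ _ _ _

theorem map_q {Ξ Γ : 𝒟} {A' : Ty.obj (op Ξ)} {A : Ty.obj (op Γ)} (C' : Comprehension τ A')
    (C : Comprehension τ A) (σ : Ξ ⟶ Γ) (h : A' = Ty.map σ.op A) :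
    Tm.map (C'.map C σ h).op C.q = C'.q :=
  lift_q _ _ _ _

theorem map_id {Γ : 𝒟} {A : Ty.obj (op Γ)} (C : Comprehension τ A) (h : A = Ty.map (𝟙 Γ).op A) :
    C.map C (𝟙 Γ) h = 𝟙 C.ext := by
  refine C.hom_ext ?_ ?_
  · rw [map_p, Category.comp_id, Category.id_comp]
  · rw [map_q, op_id, Functor.map_id_apply]

theorem map_comp {Θ Ξ Γ : 𝒟} {A'' : Ty.obj (op Θ)} {A' : Ty.obj (op Ξ)} {A : Ty.obj (op Γ)}
    (C'' : Comprehension τ A'') (C' : Comprehension τ A') (C : Comprehension τ A)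
    (ρ : Θ ⟶ Ξ) (σ : Ξ ⟶ Γ) (h' : A'' = Ty.map ρ.op A') (h : A' = Ty.map σ.op A)
    (h'' : A'' = Ty.map (ρ ≫ σ).op A) :
    C''.map C (ρ ≫ σ) h'' = C''.map C' ρ h' ≫ C'.map C σ h := by
  refine C.hom_ext ?_ ?_
  · rw [map_p, Category.assoc, map_p, ← Category.assoc, ← Category.assoc, map_p]
  · rw [map_q, op_comp, Functor.map_comp_apply, map_q, map_q]

/-- A cone over `σ` and `C.p` is a map to `Ξ` together with a term of the substituted type, which is
exactly what `C'` represents. -/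
theorem isPullback_map {Ξ Γ : 𝒟} {A' : Ty.obj (op Ξ)} {A : Ty.obj (op Γ)}
    (C' : Comprehension τ A') (C : Comprehension τ A) (σ : Ξ ⟶ Γ) (h : A' = Ty.map σ.op A) :
    IsPullback C'.p (C'.map C σ h) σ C.p := by
  have hs (s : PullbackCone σ C.p) :
      τ.app (op s.pt) (Tm.map s.snd.op C.q) = Ty.map s.fst.op A' := by
    rw [NatTrans.naturality_apply, C.q_type, h, ← Functor.map_comp_apply,
      ← Functor.map_comp_apply, ← op_comp, ← op_comp, s.condition]
  refine ⟨⟨(map_p C' C σ h).symm⟩, ⟨PullbackCone.IsLimit.mk _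
    (fun s => C'.lift s.fst (Tm.map s.snd.op C.q) (hs s)) (fun s => lift_p _ _ _ _)
    (fun s => C.hom_ext ?_ ?_) (fun s m h₁ h₂ => C'.hom_ext ?_ ?_)⟩⟩
  · rw [Category.assoc, map_p, ← Category.assoc, lift_p, s.condition]
  · rw [op_comp, Functor.map_comp_apply, map_q, lift_q]
  · rw [lift_p, h₁]
  · rw [lift_q, ← h₂, op_comp, Functor.map_comp_apply, map_q]

/-! ### Comprehensions of the substitution instances of one type -/

section extFunctor

variable {𝒪 : Type*} [Category 𝒪] {X : 𝒟} (e : 𝒪 ⥤ Over X) (A₀ : Ty.obj (op X))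
  (A : ∀ O, Ty.obj (op (e.obj O).left)) (hA : ∀ O, A O = Ty.map (e.obj O).hom.op A₀)
  (C : ∀ O, Comprehension τ (A O))

include hA in
theorem type_naturality {O O' : 𝒪} (f : O ⟶ O') : A O = Ty.map (e.map f).left.op (A O') := by
  rw [hA, hA, ← Functor.map_comp_apply, ← op_comp, Over.w]

/-- The comprehensions of a family of types obtained by substitution from one type, as a functor. -/
noncomputable def extFunctor : 𝒪 ⥤ 𝒟 where
  obj O := (C O).ext
  map f := (C _).map (C _) (e.map f).left (type_naturality e A₀ A hA f)
  map_id O := by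
    refine Eq.trans ?_ ((C O).map_id (by rw [op_id, Functor.map_id_apply]))
    congr 1; simp
  map_comp f g := by
    refine Eq.trans ?_ (map_comp (C _) (C _) (C _) (e.map f).left (e.map g).left
      (type_naturality e A₀ A hA f) (type_naturality e A₀ A hA g)
      (by rw [← Over.comp_left, ← Functor.map_comp]; exact type_naturality e A₀ A hA (f ≫ g)))
    congr 1; simp

/-- The comprehensions of a family of types obtained by substitution from a type `A₀` are pullbacks
of the comprehension of `A₀`. -/
noncomputable def extFunctorIso [HasPullbacks 𝒟] (C₀ : Comprehension τ A₀) :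
    extFunctor e A₀ A hA C ≅ e ⋙ Over.pullback C₀.p ⋙ Over.forget _ :=
  NatIso.ofComponents
    (fun O => (isPullback_map (C O) C₀ (e.obj O).hom (hA O)).isoPullback)
    (fun {O O'} f => by
      have h₁ := (isPullback_map (C O) C₀ (e.obj O).hom (hA O)).isoPullback_hom_fst
      have h₂ := (isPullback_map (C O) C₀ (e.obj O).hom (hA O)).isoPullback_hom_snd
      have h₁' := (isPullback_map (C O') C₀ (e.obj O').hom (hA O')).isoPullback_hom_fst
      have h₂' := (isPullback_map (C O') C₀ (e.obj O').hom (hA O')).isoPullback_hom_snd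
      have hm : (C O).map C₀ (e.obj O).hom (hA O) =
          (C O).map (C O') (e.map f).left (type_naturality e A₀ A hA f) ≫
            (C O').map C₀ (e.obj O').hom (hA O') := by
        rw [← map_comp (C O) (C O') C₀ (e.map f).left (e.obj O').hom
          (type_naturality e A₀ A hA f) (hA O') (by rw [Over.w]; exact hA O)]
        congr 1; exact (Over.w _).symm
      refine pullback.hom_ext ?_ ?_
      · refine (Category.assoc _ _ _).trans ((congrArg _ h₁').trans ?_)
        refine (map_p (C O) (C O') _ (type_naturality e A₀ A hA f)).trans ?_
        refine Eq.trans ?_ (Category.assoc _ _ _).symm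
        refine Eq.trans ?_ (congrArg _ (pullback.lift_fst _ _ _).symm)
        exact (congrArg (· ≫ (e.map f).left) h₁.symm).trans (Category.assoc _ _ _)
      · refine (Category.assoc _ _ _).trans ((congrArg _ h₂').trans ?_)
        refine hm.symm.trans ?_
        refine Eq.trans ?_ (Category.assoc _ _ _).symm
        exact h₂.symm.trans (congrArg _ (pullback.lift_snd _ _ _).symm))

/-- By `extFunctorIso` the functor is a composite of left adjoints: `e`, pullback along `C₀.p`, and
the forgetful functor of a slice, whose right adjoint is given by products. -/
theorem isLeftAdjoint_extFunctor [HasFiniteLimits 𝒟]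
    (h : ∀ {Y Z : 𝒟} (f : Y ⟶ Z), (Over.pullback f).IsLeftAdjoint) [e.IsLeftAdjoint]
    (C₀ : Comprehension τ A₀) : (extFunctor e A₀ A hA C).IsLeftAdjoint := by
  have := h C₀.p
  have : (Over.forget C₀.ext).IsLeftAdjoint := ⟨_, ⟨Over.forgetAdjStar _⟩⟩
  exact Functor.isLeftAdjoint_of_iso (extFunctorIso e A₀ A hA C C₀).symm

end extFunctor

end Comprehension

/-! ### Slices and adjunctions -/

section toOver

variable {𝒞 𝒟 : Type*} [Category 𝒞] [Category 𝒟] {G : 𝒟 ⥤ 𝒞} {R : 𝒞 ⥤ 𝒟}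
  (adj : CategoryTheory.Adjunction G R) (V : 𝒞)

/-- Transposition, as a functor from a comma category to a slice. -/
def costructuredArrowToOver : CostructuredArrow G V ⥤ Over (R.obj V) where
  obj O := Over.mk (adj.homEquiv _ _ O.hom)
  map f := Over.homMk f.left (by
    simp [← CategoryTheory.Adjunction.homEquiv_naturality_left])

/-- A map `G.obj Y ⟶ V` and its transpose `Y ⟶ R.obj V` are the same data, naturally in `Y`. -/
instance : (costructuredArrowToOver adj V).IsEquivalence where
  faithful := ⟨fun {_ _ f g} h => by
    ext; exact congrArg Over.Hom.left h⟩
  full := ⟨fun {X Y} f => ⟨CostructuredArrow.homMk f.left (by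
    have h : f.left ≫ adj.homEquiv Y.left V Y.hom = adj.homEquiv X.left V X.hom := Over.w f
    exact (adj.homEquiv _ _).injective ((adj.homEquiv_naturality_left _ _).trans h)),
    by ext; rfl⟩⟩
  essSurj := ⟨fun Y => ⟨CostructuredArrow.mk ((adj.homEquiv _ _).symm Y.hom),
    ⟨Over.isoMk (Iso.refl _) ((Category.id_comp _).trans (Equiv.apply_symm_apply _ _).symm)⟩⟩⟩

theorem hasPullbacks_costructuredArrow (adj : CategoryTheory.Adjunction G R) [HasPullbacks 𝒟] :
    HasPullbacks (CostructuredArrow G V) :=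
  CategoryTheory.Adjunction.hasLimitsOfShape_of_equivalence (costructuredArrowToOver adj V)

end toOver

/-! ### Natural choices of diagonal fillers -/

/-- Diagonal fillers of squares from a natural transformation between left adjoints to a fixed
morphism can be chosen naturally, as there is a universal such square. -/
theorem exists_natural_fillers {𝒪 𝒞 : Type*} [Category 𝒪] [Category 𝒞] [HasPullbacks 𝒪]
    (H K : 𝒪 ⥤ 𝒞) [H.IsLeftAdjoint] [K.IsLeftAdjoint] (l : H ⟶ K) {X Y : 𝒞} (π : X ⟶ Y)
    (hfill : ∀ (O : 𝒪) (b : K.obj O ⟶ Y) (g : H.obj O ⟶ X), g ≫ π = l.app O ≫ b →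
      ∃ h : K.obj O ⟶ X, h ≫ π = b ∧ l.app O ≫ h = g) :
    ∃ fill : ∀ (O : 𝒪) (b : K.obj O ⟶ Y) (g : H.obj O ⟶ X), g ≫ π = l.app O ≫ b →
        (K.obj O ⟶ X),
      (∀ O b g e, fill O b g e ≫ π = b ∧ l.app O ≫ fill O b g e = g) ∧
      ∀ {O O' : 𝒪} (f : O ⟶ O') (b : K.obj O' ⟶ Y) (g : H.obj O' ⟶ X) (e) (b' : K.obj O ⟶ Y)
        (g' : H.obj O ⟶ X) (e'), b' = K.map f ≫ b → g' = H.map f ≫ g →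
          fill O b' g' e' = K.map f ≫ fill O' b g e := by
  let aH := CategoryTheory.Adjunction.ofIsLeftAdjoint H
  let aK := CategoryTheory.Adjunction.ofIsLeftAdjoint K
  -- The component at `Y` of the mate of `l` between the right adjoints.
  let x : K.rightAdjoint.obj Y ⟶ H.rightAdjoint.obj Y :=
    aH.homEquiv _ _ (l.app _ ≫ aK.counit.app Y)
  -- Transposing both horizontal maps, a square from `l.app O` to `π` is a map from `O` into this
  -- pullback. Hence `O₀` carries the universal square, with sides `g₀` and `b₀`.
  let O₀ := pullback (H.rightAdjoint.map π) x
  let g₀ : H.obj O₀ ⟶ X := (aH.homEquiv _ _).symm (pullback.fst _ _)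
  let b₀ : K.obj O₀ ⟶ Y := (aK.homEquiv _ _).symm (pullback.snd _ _)
  have hx {O : 𝒪} (b : K.obj O ⟶ Y) :
      aK.homEquiv _ _ b ≫ x = aH.homEquiv _ _ (l.app O ≫ b) := by
    rw [← aH.homEquiv_naturality_left]
    congr 1
    rw [← Category.assoc, l.naturality, Category.assoc]
    congr 1
    rw [← aK.homEquiv_counit, Equiv.symm_apply_apply]
  have e₀ : g₀ ≫ π = l.app O₀ ≫ b₀ := by
    apply (aH.homEquiv _ _).injective
    rw [aH.homEquiv_naturality_right, ← hx, Equiv.apply_symm_apply, Equiv.apply_symm_apply]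
    exact pullback.condition
  have huniv (O : 𝒪) (b : K.obj O ⟶ Y) (g : H.obj O ⟶ X) (e : g ≫ π = l.app O ≫ b) :
      ∃! k : O ⟶ O₀, K.map k ≫ b₀ = b ∧ H.map k ≫ g₀ = g := by
    refine ⟨pullback.lift (aH.homEquiv _ _ g) (aK.homEquiv _ _ b) ?_, ⟨?_, ?_⟩, ?_⟩
    · rw [hx, ← aH.homEquiv_naturality_right, e]
    · rw [← aK.homEquiv_naturality_left_symm, pullback.lift_snd, Equiv.symm_apply_apply]
    · rw [← aH.homEquiv_naturality_left_symm, pullback.lift_fst, Equiv.symm_apply_apply]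
    · rintro k ⟨h₁, h₂⟩
      refine pullback.hom_ext ?_ ?_
      · rw [pullback.lift_fst, ← h₂, aH.homEquiv_naturality_left, Equiv.apply_symm_apply]
      · rw [pullback.lift_snd, ← h₁, aK.homEquiv_naturality_left, Equiv.apply_symm_apply]
  -- Only the universal square is filled by hypothesis; every other filler is the restriction of
  -- `h₀` along the classifying map, and naturality is uniqueness of that map.
  obtain ⟨h₀, hπ, hl⟩ := hfill O₀ b₀ g₀ e₀
  refine ⟨fun O b g e => K.map (huniv O b g e).choose ≫ h₀, fun O b g e => ⟨?_, ?_⟩, ?_⟩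
  · rw [Category.assoc, hπ, (huniv O b g e).choose_spec.1.1]
  · rw [← Category.assoc, ← l.naturality, Category.assoc, hl,
      (huniv O b g e).choose_spec.1.2]
  · rintro O O' f b g e _ _ e' rfl rfl
    rw [← Category.assoc, ← K.map_comp]
    refine congrArg (fun k => K.map k ≫ h₀) ?_
    refine (huniv _ _ _ e').unique (huniv _ _ _ e').choose_spec.1 ⟨?_, ?_⟩
    · rw [K.map_comp, Category.assoc, (huniv _ _ _ e).choose_spec.1.1]
    · rw [H.map_comp, Category.assoc, (huniv _ _ _ e).choose_spec.1.2]

/-! ### Substitution in comprehensions of natural pseudo-models -/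

section

variable {C : Type u'} [Category.{v'} C]

/-- This is the associativity coherence of `T` evaluated at `A`; the associators of `Cat` have
identity components and drop out. -/
theorem psubstComp_assoc (T : Pseudofunctor (LocallyDiscrete Cᵒᵖ) Cat.{t₁, t₂}) {Θ' Θ Ξ Γ : C}
    (h : Θ' ⟶ Θ) (f : Θ ⟶ Ξ) (p : Ξ ⟶ Γ) (A : T.obj ⟨op Γ⟩) :
    (psubstComp T (h ≫ f) p).hom.app A ≫ (psubstComp T h f).hom.app ((psubst T p).obj A) =
      eqToHom (by rw [Category.assoc]) ≫ (psubstComp T h (f ≫ p)).hom.app A ≫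
        (psubst T h).map ((psubstComp T f p).hom.app A) := by
  have e := congrArg (fun x => x.toNatTrans.app A)
    (T.mapComp_assoc_right_hom p.op.toLoc f.op.toLoc h.op.toLoc)
  -- 2-cells of a locally discrete bicategory are equalities, so the image of the associator is a
  -- transport.
  have e' : ∀ {X Y : LocallyDiscrete Cᵒᵖ} {a b : X ⟶ Y} (η : a ⟶ b),
      T.map₂ η = eqToHom (congrArg T.map (LocallyDiscrete.eq_of_hom η)) := by
    intro X Y a b η
    obtain rfl := LocallyDiscrete.eq_of_hom η
    rw [Subsingleton.elim η (𝟙 _), T.map₂_id, eqToHom_refl]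
  rw [e'] at e
  refine e.trans ?_
  refine congrArg₂ (· ≫ ·) (Cat.eqToHom_app _ _ _ _) ?_
  refine congrArg (_ ≫ ·) ?_
  exact Category.comp_id _

variable {Tm Ty : Pseudofunctor (LocallyDiscrete Cᵒᵖ) Cat.{t₁, t₂}}
  (τ : Pseudofunctor.StrongTrans Tm Ty)

theorem pnat_comp {Θ Ξ Γ : C} (f : Θ ⟶ Ξ) (g : Ξ ⟶ Γ) (q : Tm.obj ⟨op Γ⟩) :
    (pnat τ (f ≫ g)).hom.app q ≫ (psubstComp Ty f g).hom.app ((pcomp τ Γ).obj q) =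
      (pcomp τ Θ).map ((psubstComp Tm f g).hom.app q) ≫
        (pnat τ f).hom.app ((psubst Tm g).obj q) ≫
          (psubst Ty f).map ((pnat τ g).hom.app q) := by
  have e := congrArg (fun x => x.toNatTrans.app q)
    (τ.naturality_comp g.op.toLoc f.op.toLoc)
  refine e.trans ?_
  refine congrArg (_ ≫ ·) ?_
  refine (Category.id_comp _).trans ?_
  refine congrArg (_ ≫ ·) ?_
  refine (Category.id_comp _).trans ?_
  exact (Category.comp_id _)

theorem psubstComp_inv_assoc (T : Pseudofunctor (LocallyDiscrete Cᵒᵖ) Cat.{t₁, t₂}) {Θ' Θ Ξ Γ : C}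
    (h : Θ' ⟶ Θ) (f : Θ ⟶ Ξ) (p : Ξ ⟶ Γ) (A : T.obj ⟨op Γ⟩) :
    (psubst T h).map ((psubstComp T f p).inv.app A) ≫ (psubstComp T h (f ≫ p)).inv.app A =
      (psubstComp T h f).inv.app ((psubst T p).obj A) ≫ (psubstComp T (h ≫ f) p).inv.app A ≫
        eqToHom (by rw [Category.assoc]) := by
  have e := psubstComp_assoc T h f p A
  have e' : IsIso ((psubstComp T (h ≫ f) p).hom.app A ≫
    (psubstComp T h f).hom.app ((psubst T p).obj A)) := inferInstance
  have k : (psubst T h).map ((psubstComp T f p).hom.app A) ≫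
      (psubst T h).map ((psubstComp T f p).inv.app A) = 𝟙 _ := by
    rw [← Functor.map_comp, Iso.hom_inv_id_app, CategoryTheory.Functor.map_id]
  rw [← cancel_epi ((psubstComp T (h ≫ f) p).hom.app A ≫
    (psubstComp T h f).hom.app ((psubst T p).obj A))]
  conv_lhs => rw [e]
  simp only [Category.assoc, Iso.hom_inv_id_app_assoc]
  rw [reassoc_of% k, Iso.hom_inv_id_app, Category.comp_id]

theorem pnat_comp_inv {Θ Ξ Γ : C} (f : Θ ⟶ Ξ) (g : Ξ ⟶ Γ) (q : Tm.obj ⟨op Γ⟩) :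
    (pcomp τ Θ).map ((psubstComp Tm f g).inv.app q) ≫ (pnat τ (f ≫ g)).hom.app q =
      (pnat τ f).hom.app ((psubst Tm g).obj q) ≫ (psubst Ty f).map ((pnat τ g).hom.app q) ≫
        (psubstComp Ty f g).inv.app ((pcomp τ Γ).obj q) := by
  have e := pnat_comp τ f g q
  have k : (pcomp τ Θ).map ((psubstComp Tm f g).inv.app q) ≫
      (pcomp τ Θ).map ((psubstComp Tm f g).hom.app q) = 𝟙 _ := by
    rw [← Functor.map_comp, Iso.inv_hom_id_app, CategoryTheory.Functor.map_id]
  rw [← cancel_mono ((psubstComp Ty f g).hom.app ((pcomp τ Γ).obj q)), Category.assoc, e,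
    reassoc_of% k]
  simp only [Category.assoc]
  rw [Iso.inv_hom_id_app]
  exact congrArg (_ ≫ ·) (Category.comp_id _).symm

variable {τ}

/-- Substitution of an identification `τ t ≅ A[σ]`. -/
abbrev substTypeIso {Θ Ξ Γ : C} (g : Θ ⟶ Ξ) {σ : Ξ ⟶ Γ} {t : Tm.obj ⟨op Ξ⟩} {A : Ty.obj ⟨op Γ⟩}
    (ψ : (pcomp τ Ξ).obj t ≅ (psubst Ty σ).obj A) :
    (pcomp τ Θ).obj ((psubst Tm g).obj t) ≅ (psubst Ty (g ≫ σ)).obj A :=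
  (pnat τ g).app t ≪≫ (psubst Ty g).mapIso ψ ≪≫ (psubstComp Ty g σ).symm.app A

/-! ### Classifying maps into a comprehension, and their stability under substitution -/

namespace PseudoComprehension

variable {Γ : C} {A : Ty.obj ⟨op Γ⟩} (X : PseudoComprehension τ A)

/-- `f` is a morphism into the comprehension classifying the term `t` of type `A[σ]`. -/
def Classifies {Ξ : C} (f : Ξ ⟶ X.ext) (σ : Ξ ⟶ Γ) (t : Tm.obj ⟨op Ξ⟩)
    (ψ : (pcomp τ Ξ).obj t ≅ (psubst Ty σ).obj A) : Prop :=
  ∃ (e : f ≫ X.p = σ) (θ : t ≅ (psubst Tm f).obj X.q),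
    ψ.hom = (pcomp τ Ξ).map θ.hom ≫ (substTypeIso f X.q_type).hom ≫ eqToHom (by rw [e])

theorem existsUnique_classifies {Ξ : C} (σ : Ξ ⟶ Γ) (t : Tm.obj ⟨op Ξ⟩)
    (ψ : (pcomp τ Ξ).obj t ≅ (psubst Ty σ).obj A) : ∃! f, X.Classifies f σ t ψ := by
  obtain ⟨f, ⟨e, θ, h⟩, hf⟩ := X.isUniversal σ t ψ
  refine ⟨f, ⟨e, θ, by simpa using h⟩, ?_⟩
  rintro f' ⟨e', θ', h'⟩
  exact hf f' ⟨e', θ', by simpa using h'⟩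

variable {X}

/-- Naturality of `pnat` and `psubstComp` moves `θ` and `X.q_type` past the substitution, and the
coherence laws for composites rewrite the result as substitution along `g ≫ f`. -/
theorem Classifies.subst {Θ Ξ : C} {f : Ξ ⟶ X.ext} {σ : Ξ ⟶ Γ} {t : Tm.obj ⟨op Ξ⟩}
    {ψ : (pcomp τ Ξ).obj t ≅ (psubst Ty σ).obj A} (h : X.Classifies f σ t ψ) (g : Θ ⟶ Ξ) :
    X.Classifies (g ≫ f) (g ≫ σ) ((psubst Tm g).obj t) (substTypeIso g ψ) := by
  obtain ⟨rfl, θ, h⟩ := h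
  refine ⟨Category.assoc _ _ _, (psubst Tm g).mapIso θ ≪≫ (psubstComp Tm g f).symm.app X.q, ?_⟩
  have n₁ := (pnat τ g).hom.naturality θ.hom
  have n₂ := (psubstComp Ty g f).inv.naturality X.q_type.hom
  have n₃ := psubstComp_inv_assoc Ty g f X.p A
  have n₄ := pnat_comp_inv τ g f X.q
  simp only [Functor.comp_map, Functor.comp_obj] at n₁ n₂
  simp only [Iso.trans_hom, Iso.app_hom, Functor.mapIso_hom, Iso.symm_hom, h,
    Functor.map_comp, Category.assoc, eqToHom_refl, Category.comp_id]
  rw [← reassoc_of% n₁, reassoc_of% n₄, n₃]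
  refine congrArg (_ ≫ _ ≫ _ ≫ ·) ?_
  exact (reassoc_of% n₂) _

variable (X) in
theorem classifies_self {Ξ : C} (f : Ξ ⟶ X.ext) :
    X.Classifies f (f ≫ X.p) ((psubst Tm f).obj X.q) (substTypeIso f X.q_type) :=
  ⟨rfl, Iso.refl _, by simp⟩

theorem Classifies.unique {Ξ : C} {f f' : Ξ ⟶ X.ext} {σ : Ξ ⟶ Γ} {t : Tm.obj ⟨op Ξ⟩}
    {ψ : (pcomp τ Ξ).obj t ≅ (psubst Ty σ).obj A} (h : X.Classifies f σ t ψ)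
    (h' : X.Classifies f' σ t ψ) : f = f' :=
  (X.existsUnique_classifies σ t ψ).unique h h'

theorem Classifies.congr {Ξ : C} {f : Ξ ⟶ X.ext} {σ σ' : Ξ ⟶ Γ} {t t' : Tm.obj ⟨op Ξ⟩}
    {ψ : (pcomp τ Ξ).obj t ≅ (psubst Ty σ).obj A} (h : X.Classifies f σ t ψ) (e : σ = σ')
    (θ : t' ≅ t) {ψ' : (pcomp τ Ξ).obj t' ≅ (psubst Ty σ').obj A}
    (hψ : ψ'.hom = (pcomp τ Ξ).map θ.hom ≫ ψ.hom ≫ eqToHom (by rw [e])) :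
    X.Classifies f σ' t' ψ' := by
  subst e
  obtain ⟨e, θ', h⟩ := h
  exact ⟨e, θ ≪≫ θ', by simp [hψ, h]⟩

variable (X) in
/-- Comprehensions are stable under substitution: the comprehension of `A[σ]` is a pullback of that
of `A`. -/
theorem exists_isPullback {Ξ : C} (σ : Ξ ⟶ Γ)
    (Y : PseudoComprehension τ ((psubst Ty σ).obj A)) :
    ∃ k : Y.ext ⟶ X.ext, IsPullback k Y.p X.p σ := by
  -- The coherence isomorphism between iterated substitution and substitution along `a ≫ σ` turns
  -- terms of type `A[σ]` over `a` into terms of type `A` over `a ≫ σ`. The map `k` classifies the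
  -- generic term of `Y` read in this way.
  let φ {Θ : C} (a : Θ ⟶ Ξ) {t : Tm.obj ⟨op Θ⟩}
      (ψ : (pcomp τ Θ).obj t ≅ (psubst Ty a).obj ((psubst Ty σ).obj A)) :
      (pcomp τ Θ).obj t ≅ (psubst Ty (a ≫ σ)).obj A := ψ ≪≫ (psubstComp Ty a σ).symm.app A
  obtain ⟨k, hk, -⟩ := X.existsUnique_classifies (Y.p ≫ σ) Y.q (φ Y.p Y.q_type)
  have key {Θ : C} (m : Θ ⟶ Y.ext) : X.Classifies (m ≫ k) ((m ≫ Y.p) ≫ σ)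
      ((psubst Tm m).obj Y.q) (φ (m ≫ Y.p) (substTypeIso m Y.q_type)) := by
    refine (hk.subst m).congr (Category.assoc _ _ _).symm (Iso.refl _) ?_
    have n := psubstComp_inv_assoc Ty m Y.p σ A
    simp only [φ, Iso.trans_hom, Iso.app_hom, Functor.mapIso_hom, Iso.symm_hom,
      Functor.map_comp, Category.assoc, Iso.refl_hom, CategoryTheory.Functor.map_id,
      Category.id_comp, reassoc_of% n, eqToHom_trans, eqToHom_refl, Category.comp_id]
  have key' {Θ : C} {m : Θ ⟶ Y.ext} {a : Θ ⟶ Ξ} {t : Tm.obj ⟨op Θ⟩}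
      {ψ : (pcomp τ Θ).obj t ≅ (psubst Ty a).obj ((psubst Ty σ).obj A)}
      (h : Y.Classifies m a t ψ) : X.Classifies (m ≫ k) (a ≫ σ) t (φ a ψ) := by
    obtain ⟨rfl, θ, h⟩ := h
    exact (key m).congr rfl θ (by simp [φ, h])
  have hkp : k ≫ X.p = Y.p ≫ σ := hk.choose
  have hex {Θ : C} (b : Θ ⟶ X.ext) (a : Θ ⟶ Ξ) (hab : b ≫ X.p = a ≫ σ) :
      ∃! m : Θ ⟶ Y.ext, m ≫ k = b ∧ m ≫ Y.p = a := by
    -- A cone gives the term classified by `b`, regarded over `a ≫ σ`. Undoing `φ` makes it a term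
    -- over `a`, and the map into `Y.ext` classifying that term is the required lift.
    let χ : (pcomp τ Θ).obj ((psubst Tm b).obj X.q) ≅ (psubst Ty (a ≫ σ)).obj A :=
      substTypeIso b X.q_type ≪≫ eqToIso (by rw [hab])
    let ψ : (pcomp τ Θ).obj ((psubst Tm b).obj X.q) ≅
        (psubst Ty a).obj ((psubst Ty σ).obj A) := χ ≪≫ (psubstComp Ty a σ).app A
    have hφψ : φ a ψ = χ := by ext; simp [φ, ψ]
    have hb : X.Classifies b (a ≫ σ) ((psubst Tm b).obj X.q) χ :=
      (X.classifies_self b).congr hab (Iso.refl _) (by simp [χ])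
    obtain ⟨m, hm, hm'⟩ := Y.existsUnique_classifies a _ ψ
    refine ⟨m, ⟨(key' hm).unique (hφψ ▸ hb), hm.choose⟩, ?_⟩
    rintro m' ⟨rfl, rfl⟩
    refine hm' _ ?_
    -- Here `θ` compares the generic terms of `Y` and `X` pulled back to `Θ`; transport along its
    -- inverse shows that `m'` also classifies `ψ`.
    obtain ⟨_, θ, h⟩ := key m'
    refine (Y.classifies_self m').congr rfl θ.symm ?_
    have h' : (substTypeIso m' Y.q_type).hom =
        (pcomp τ Θ).map θ.hom ≫ χ.hom ≫ (psubstComp Ty (m' ≫ Y.p) σ).hom.app A := by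
      rw [← cancel_mono ((psubstComp Ty (m' ≫ Y.p) σ).inv.app A)]
      refine h.trans ?_
      simp [χ]
    rw [h', eqToHom_refl, Category.comp_id, ← Category.assoc, ← Functor.map_comp, Iso.symm_hom,
      Iso.inv_hom_id, CategoryTheory.Functor.map_id, Category.id_comp]
    rfl
  refine ⟨k, ⟨hkp⟩, ⟨PullbackCone.IsLimit.mk _
    (fun s => (hex s.fst s.snd s.condition).choose)
    (fun s => (hex s.fst s.snd s.condition).choose_spec.1.1)
    (fun s => (hex s.fst s.snd s.condition).choose_spec.1.2)
    (fun s m h₁ h₂ => (hex s.fst s.snd s.condition).choose_spec.2 m ⟨h₁, h₂⟩)⟩⟩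

end PseudoComprehension

end

/-! ### Fillers against stably anodyne morphisms, and comprehensions of split types -/

namespace NaturalPseudoModel

variable {C : Type u'} [Category.{v'} C] {N : NaturalPseudoModel.{t₁, t₂, v', u'} C}

/-- An anodyne map lifts only against projections over its own codomain. A general square reduces to
that case by substituting `E` along `b`, since the new comprehension is a pullback of the old one.
-/
theorem StablyAnodyne.exists_filler {Γ Ξ Γ' Ξ' : C} {f : Γ ⟶ Ξ} (hf : N.StablyAnodyne f)
    {a : Γ' ⟶ Γ} {f' : Γ' ⟶ Ξ'} {c : Ξ' ⟶ Ξ} (sq : IsPullback a f' f c) {V : C}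
    (E : N.Ty.obj ⟨op V⟩) (b : Ξ' ⟶ V) (g : Γ' ⟶ (N.compr E).ext)
    (e : g ≫ (N.compr E).p = f' ≫ b) :
    ∃ h : Ξ' ⟶ (N.compr E).ext, h ≫ (N.compr E).p = b ∧ f' ≫ h = g := by
  obtain ⟨k, hk⟩ := (N.compr E).exists_isPullback b (N.compr ((psubst N.Ty b).obj E))
  obtain ⟨h, h₁, h₂⟩ := hf a f' c sq ((psubst N.Ty b).obj E) (hk.lift g f' e) (hk.lift_snd _ _ _)
  refine ⟨h ≫ k, ?_, ?_⟩
  · rw [Category.assoc, hk.w, ← Category.assoc, h₁, Category.id_comp]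
  · rw [← Category.assoc, h₂, hk.lift_fst]

/-- Equality of split types forces the local universes and the types over them to agree, so after
eliminating the equation a term is just a map over the universe, with no transport left. -/
theorem SplitTm.exists_term {Γ : C} (t : N.SplitTm Γ) (A : N.SplitTy Γ)
    (h : N.splitτ.app (op Γ) t = A) :
    ∃ x : Γ ⟶ (N.compr A.type).ext, x ≫ (N.compr A.type).p = A.name ∧
      t = (⟨A.base, A.type, x⟩ : N.SplitTm Γ) := by
  subst h
  exact ⟨t.term, rfl, rfl⟩

variable {D : Type*} [Category.{v'} D] {G : D ⥤ C}

section

variable {Γ : D} {A : N.SplitTy (G.obj Γ)}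
  (X : Comprehension (Functor.whiskerLeft G.op N.splitτ) (Γ := Γ) A)

/-- The morphism underlying the generic term of a comprehension of a split type. -/
noncomputable def genericTerm : G.obj X.ext ⟶ (N.compr A.type).ext :=
  (SplitTm.exists_term (N := N) X.q ⟨A.base, A.type, G.map X.p ≫ A.name⟩ X.q_type).choose

theorem genericTerm_p : genericTerm X ≫ (N.compr A.type).p = G.map X.p ≫ A.name :=
  (SplitTm.exists_term (N := N) X.q ⟨A.base, A.type, G.map X.p ≫ A.name⟩ X.q_type).choose_spec.1

theorem q_eq_genericTerm :
    X.q = (⟨A.base, A.type, genericTerm X⟩ : N.SplitTm (G.obj X.ext)) :=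
  (SplitTm.exists_term (N := N) X.q ⟨A.base, A.type, G.map X.p ≫ A.name⟩ X.q_type).choose_spec.2

theorem splitTm_mk_injective {Ξ : C} {V : C} {E : N.Ty.obj ⟨op V⟩}
    {x y : Ξ ⟶ (N.compr E).ext} (h : (⟨V, E, x⟩ : N.SplitTm Ξ) = ⟨V, E, y⟩) : x = y := by
  simpa using h

theorem map_q_eq_iff {Ξ : D} (f : Ξ ⟶ X.ext) (x : G.obj Ξ ⟶ (N.compr A.type).ext) :
    (G.op ⋙ N.splitTm).map f.op X.q = (⟨A.base, A.type, x⟩ : N.SplitTm (G.obj Ξ)) ↔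
      G.map f ≫ genericTerm X = x := by
  rw [q_eq_genericTerm]
  exact ⟨fun h => splitTm_mk_injective h, fun h => congrArg (SplitTm.mk A.base A.type) h⟩

theorem comprehension_hom_ext {Ξ : D} {f g : Ξ ⟶ X.ext} (hp : f ≫ X.p = g ≫ X.p)
    (hq : G.map f ≫ genericTerm X = G.map g ≫ genericTerm X) : f = g :=
  X.hom_ext hp (((map_q_eq_iff X f _).2 hq).trans ((map_q_eq_iff X g _).2 rfl).symm)

theorem existsUnique_lift {Ξ : D} (σ : Ξ ⟶ Γ) (x : G.obj Ξ ⟶ (N.compr A.type).ext)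
    (h : x ≫ (N.compr A.type).p = G.map σ ≫ A.name) :
    ∃! f : Ξ ⟶ X.ext, f ≫ X.p = σ ∧ G.map f ≫ genericTerm X = x := by
  obtain ⟨f, hf, hf'⟩ := X.isUniversal σ (⟨A.base, A.type, x⟩ : N.SplitTm (G.obj Ξ))
    (congrArg (SplitTy.mk A.base A.type) h)
  exact ⟨f, ⟨hf.1, (map_q_eq_iff X f x).1 hf.2⟩,
    fun g hg => hf' g ⟨hg.1, (map_q_eq_iff X g x).2 hg.2⟩⟩

/-- A map into `X.ext` is a map `σ` to `Γ` with a lift of `G.map σ ≫ A.name` along the type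
projection; transposing the lift across `adj` turns this into a cone. -/
theorem isPullback_transpose {R : C ⥤ D} (adj : CategoryTheory.Adjunction G R) :
    IsPullback (adj.homEquiv _ _ (genericTerm X)) X.p (R.map (N.compr A.type).p)
      (adj.homEquiv _ _ A.name) := by
  have hw : adj.homEquiv _ _ (genericTerm X) ≫ R.map (N.compr A.type).p =
      X.p ≫ adj.homEquiv _ _ A.name := by
    rw [← adj.homEquiv_naturality_right, ← adj.homEquiv_naturality_left, genericTerm_p]
  have hs (s : PullbackCone (R.map (N.compr A.type).p) (adj.homEquiv _ _ A.name)) :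
      (adj.homEquiv _ _).symm s.fst ≫ (N.compr A.type).p = G.map s.snd ≫ A.name := by
    rw [← adj.homEquiv_naturality_right_symm, s.condition, adj.homEquiv_naturality_left_symm,
      Equiv.symm_apply_apply]
  refine ⟨⟨hw⟩, ⟨PullbackCone.IsLimit.mk _
    (fun s => (existsUnique_lift X s.snd _ (hs s)).choose) (fun s => ?_)
    (fun s => (existsUnique_lift X s.snd _ (hs s)).choose_spec.1.1) (fun s m h₁ h₂ => ?_)⟩⟩
  · rw [← adj.homEquiv_naturality_left,
      (existsUnique_lift X s.snd _ (hs s)).choose_spec.1.2, Equiv.apply_symm_apply]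
  · refine (existsUnique_lift X s.snd _ (hs s)).choose_spec.2 m ⟨h₂, ?_⟩
    rw [← h₁, adj.homEquiv_naturality_left_symm, Equiv.symm_apply_apply]

end

variable (N) in
-- The comprehension is constructed as the pullback described by `isPullback_transpose`, its generic
-- term being the transpose of the first projection.
theorem representable_whiskerLeft [HasPullbacks D] {R : C ⥤ D}
    (adj : CategoryTheory.Adjunction G R) :
    Representable (Functor.whiskerLeft G.op N.splitτ) := by
  intro Γ A
  change N.SplitTy (G.obj Γ) at A
  let x := pullback.fst (R.map (N.compr A.type).p) (adj.homEquiv _ _ A.name)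
  let p := pullback.snd (R.map (N.compr A.type).p) (adj.homEquiv _ _ A.name)
  have hw : x ≫ R.map (N.compr A.type).p = p ≫ adj.homEquiv _ _ A.name := pullback.condition
  refine ⟨⟨_, p, (⟨A.base, A.type, (adj.homEquiv _ _).symm x⟩ : N.SplitTm (G.obj _)), ?_, ?_⟩⟩
  · refine congrArg (SplitTy.mk A.base A.type) ?_
    change _ = G.map p ≫ A.name
    rw [← adj.homEquiv_naturality_right_symm, hw, adj.homEquiv_naturality_left_symm,
      Equiv.symm_apply_apply]
  · intro Ξ σ t h
    obtain ⟨y, hy, rfl⟩ := SplitTm.exists_term (N := N) t ⟨A.base, A.type, G.map σ ≫ A.name⟩ h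
    have hy' : adj.homEquiv _ _ y ≫ R.map (N.compr A.type).p = σ ≫ adj.homEquiv _ _ A.name := by
      rw [← adj.homEquiv_naturality_right, ← adj.homEquiv_naturality_left]
      exact congrArg _ hy
    refine ⟨pullback.lift _ _ hy', ⟨pullback.lift_snd _ _ _, ?_⟩, ?_⟩
    · refine congrArg (SplitTm.mk A.base A.type) ?_
      change G.map _ ≫ _ = y
      rw [← adj.homEquiv_naturality_left_symm]
      exact (congrArg _ (pullback.lift_fst _ _ hy')).trans (Equiv.symm_apply_apply _ _)
    · rintro f ⟨h₁, h₂⟩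
      have h₃ : G.map f ≫ (adj.homEquiv _ _).symm x = y := splitTm_mk_injective h₂
      refine pullback.hom_ext ?_ ?_
      · rw [pullback.lift_fst, ← h₃, adj.homEquiv_naturality_left, Equiv.apply_symm_apply]
      · rw [pullback.lift_snd, ← h₁]

end NaturalPseudoModel

/-! ### Right adjoints compatible with a functor -/

/-- A right adjoint `R` of `G` together with an isomorphism between `R ⋙ K` and `M`. -/
structure RightAdjointOver {D C C' : Type*} [Category D] [Category C] [Category C'] (G : D ⥤ C)
    (K : D ⥤ C') (M : C ⥤ C') where
  R : C ⥤ D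
  adj : CategoryTheory.Adjunction G R
  iso : R ⋙ K ≅ M

namespace RightAdjointOver

variable {D C C' : Type*} [Category D] [Category C] [Category C'] {G : D ⥤ C}
    {K : D ⥤ C'} {M : C ⥤ C'} (X : RightAdjointOver G K M)

/-- The unit of the adjunction, transported along the isomorphism. -/
def unit : K ⟶ G ⋙ M where
  app Γ := K.map (X.adj.unit.app Γ) ≫ X.iso.hom.app (G.obj Γ)
  naturality Γ Ξ σ := by
    have h₁ := X.adj.unit.naturality σ
    have h₂ := X.iso.hom.naturality (G.map σ)
    simp only [Functor.id_map, Functor.comp_map] at h₁ h₂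
    rw [← Category.assoc, ← K.map_comp]
    refine (congrArg (fun x => K.map x ≫ _) h₁).trans ?_
    rw [K.map_comp, Category.assoc, Category.assoc]
    exact congrArg _ h₂

theorem unit_naturality {Γ Ξ : D} (σ : Γ ⟶ Ξ) :
    K.map σ ≫ X.unit.app Ξ = X.unit.app Γ ≫ M.map (G.map σ) :=
  X.unit.naturality σ

theorem unit_naturality_assoc {Γ Ξ : D} (σ : Γ ⟶ Ξ) {Y : C'} (f : M.obj (G.obj Ξ) ⟶ Y) :
    K.map σ ≫ X.unit.app Ξ ≫ f = X.unit.app Γ ≫ M.map (G.map σ) ≫ f := by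
  rw [← Category.assoc, X.unit_naturality, Category.assoc]

/-- After applying `K`, transposition becomes `M` preceded by the unit. This lets `X.R` disappear
from later statements, leaving only `M` and the comparison `X.unit`. -/
theorem map_homEquiv {Γ : D} {V : C} (x : G.obj Γ ⟶ V) :
    K.map (X.adj.homEquiv _ _ x) ≫ X.iso.hom.app V = X.unit.app Γ ≫ M.map x := by
  rw [X.adj.homEquiv_unit, K.map_comp, Category.assoc]
  refine (congrArg _ (X.iso.hom.naturality x)).trans ?_
  exact (Category.assoc _ _ _).symm

/-- Transport along isomorphisms of functors. -/
def congr {G' : D ⥤ C} {M' : C ⥤ C'} (e : G ≅ G') (e' : M ≅ M') : RightAdjointOver G' K M' where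
  R := X.R
  adj := X.adj.ofNatIsoLeft e
  iso := X.iso ≪≫ e'

theorem congr_unit_app {G' : D ⥤ C} {M' : C ⥤ C'} (e : G ≅ G') (e' : M ≅ M') (Γ : D) :
    (X.congr e e').unit.app Γ = X.unit.app Γ ≫ M.map (e.hom.app Γ) ≫ e'.hom.app _ := by
  have h := X.map_homEquiv (e.hom.app Γ)
  have h' : (X.congr e e').adj.unit.app Γ = X.adj.homEquiv _ _ (e.hom.app Γ) := by
    simp [congr, CategoryTheory.Adjunction.ofNatIsoLeft, Adjunction.homEquiv_unit]
  refine (congrArg (fun x => K.map x ≫ (X.congr e e').iso.hom.app _) h').trans ?_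
  refine (Category.assoc _ _ _).symm.trans ?_
  refine (congrArg (· ≫ e'.hom.app _) h).trans ?_
  exact Category.assoc _ _ _

/-- A fully faithful right adjoint. -/
noncomputable def ofReflective {F : D ⥤ C} {i : C ⥤ D} (adj : CategoryTheory.Adjunction F i)
    [i.Full] [i.Faithful] : RightAdjointOver F F (𝟭 C) where
  R := i
  adj := adj
  iso := asIso adj.counit

/-- One of the triangle identities. -/
theorem ofReflective_unit_app {F : D ⥤ C} {i : C ⥤ D} (adj : CategoryTheory.Adjunction F i)
    [i.Full] [i.Faithful] (Γ : D) : (ofReflective adj).unit.app Γ = 𝟙 _ :=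
  adj.left_triangle_components Γ

/-- Precomposition with an adjunction. -/
noncomputable def ofReflectiveComp {F : D ⥤ C} {i : C ⥤ D} (adj : CategoryTheory.Adjunction F i)
    [i.Full] [i.Faithful] {H : C ⥤ C'} {H' : C' ⥤ C} (adj' : CategoryTheory.Adjunction H H') :
    RightAdjointOver (F ⋙ H) F H' where
  R := H' ⋙ i
  adj := adj.comp adj'
  iso := Functor.associator _ _ _ ≪≫ Functor.isoWhiskerLeft H' (asIso adj.counit) ≪≫ H'.rightUnitor

section comp

variable {D' C'' : Type*} [Category D'] [Category C''] {H : D' ⥤ D} {H' : D ⥤ D'}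
  (adj : CategoryTheory.Adjunction H H') {K' : D' ⥤ C''} {M' : C' ⥤ C''}
  (θ : H' ⋙ K' ≅ K ⋙ M')

/-- Composition with an adjunction. -/
def comp : RightAdjointOver (H ⋙ G) K' (M ⋙ M') where
  R := X.R ⋙ H'
  adj := adj.comp X.adj
  iso := Functor.associator _ _ _ ≪≫ Functor.isoWhiskerLeft X.R θ ≪≫
    (Functor.associator _ _ _).symm ≪≫ Functor.isoWhiskerRight X.iso M'

theorem comp_unit_app (Γ : D') : (X.comp adj θ).unit.app Γ =
    K'.map (adj.unit.app Γ) ≫ θ.hom.app (H.obj Γ) ≫ M'.map (X.unit.app (H.obj Γ)) := by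
  have h := θ.hom.naturality (X.adj.unit.app (H.obj Γ))
  simp only [Functor.comp_map] at h
  simp only [unit, comp, CategoryTheory.Adjunction.comp_unit_app, Functor.map_comp, Category.assoc]
  refine congrArg _ ?_
  refine Eq.trans ?_ ((Category.assoc _ _ _).symm.trans ((congrArg (· ≫ _) h).trans
    (Category.assoc _ _ _)))
  refine congrArg _ ?_
  simp

end comp

end RightAdjointOver

/-- `K` preserves the pullback of `isPullback_transpose`, and `Y.iso` rewrites the image of `Y.R` as
`M`. -/
theorem NaturalPseudoModel.isPullback_unit {C D C' : Type*} [Category.{v'} C] [Category.{v'} D]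
    [Category C'] {N : NaturalPseudoModel.{t₁, t₂} C} {G : D ⥤ C} {K : D ⥤ C'} {M : C ⥤ C'}
    [PreservesFiniteLimits K] (Y : RightAdjointOver G K M) {Γ : D} {A : N.SplitTy (G.obj Γ)}
    (X : Comprehension (Functor.whiskerLeft G.op N.splitτ) (Γ := Γ) A) :
    IsPullback (Y.unit.app X.ext ≫ M.map (genericTerm X)) (K.map X.p) (M.map (N.compr A.type).p)
      (Y.unit.app Γ ≫ M.map A.name) := by
  refine ((isPullback_transpose X Y.adj).map K).of_iso (Iso.refl _) (Y.iso.app _) (Iso.refl _)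
    (Y.iso.app _) ?_ ?_ ?_ ?_
  · rw [← Y.map_homEquiv]; simp
  · simp
  · exact Y.iso.hom.naturality _
  · rw [← Y.map_homEquiv]; simp

/-! ### Right adjoints for sharp morphisms -/

/-- A 1-cell of `B` as a 1-cell of `B^coop`. -/
abbrev Coop.mor {B : Type u} [Bicategory.{w, v} B] {a b : B} (f : a ⟶ b) :
    (⟨b⟩ : Coop B) ⟶ ⟨a⟩ := ⟨f⟩

/-- An adjunction in `B` is also one in `B^coop`, between the same 1-cells. -/
def Coop.adjunction {B : Type u} [Bicategory.{w, v} B] {a b : B} {f : a ⟶ b} {g : b ⟶ a}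
    (adj : Bicategory.Adjunction f g) :
    Bicategory.Adjunction (Coop.mor f) (Coop.mor g) where
  unit := ⟨adj.counit⟩
  counit := ⟨adj.unit⟩
  left_triangle := by
    ext
    simpa [leftZigzag, bicategoricalComp] using adj.left_triangle
  right_triangle := by
    ext
    simpa [rightZigzag, bicategoricalComp] using adj.right_triangle

namespace ModalContextStructure

variable {K : Type u} [Bicategory.{w, v} K] (D : ModalContextStructure.{w, v, u, v', u'} K)

/-- The adjunction between `D^f` and `D^g` determined by an adjunction between `f` and `g`. -/
def lockAdj {p q : K} {f : p ⟶ q} {g : q ⟶ p} (adj : Bicategory.Adjunction f g) :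
    CategoryTheory.Adjunction (D.lock f) (D.lock g) :=
  CategoryTheory.Adjunction.ofCat (D.functor.toPseudofunctor.mapAdjunction (Coop.adjunction adj))

/-- The isomorphism between `D^f` and `D^g` determined by an isomorphism between `f` and `g`. -/
def lockIso {p q : K} {f g : p ⟶ q} (e : f ≅ g) : D.lock f ≅ D.lock g :=
  Cat.Hom.toNatIso (D.functor.map₂Iso (Coop.iso₂Mk (f := Coop.mor f) (g := Coop.mor g) e))

end ModalContextStructure

namespace AdjointModalPreModel

variable {L : Type u} [Bicategory.{w, v} L] [Bicategory.Strict L] {S : MorphismClass L}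
  (P : AdjointModalPreModel.{w, v, u, t₁, t₂, v', u'} S)

/-- The functor `C_μ` of the pre-model. -/
abbrev push {p q : FreeDagger S} (μ : p ⟶ q) :
    P.preModel.functor.obj p ⥤ P.preModel.functor.obj q :=
  (P.preModel.functor.map μ).toFunctor

/-- The right adjoint of `D^ϱ` for `ϱ` in `L`. -/
abbrev lockDag {q r : L} (ϱ : q ⟶ r) : P.context.Ctx ⟨q⟩ ⥤ P.context.Ctx ⟨r⟩ :=
  P.hat.lock (FreeDagger.dag ϱ trivial)

/-- The adjunction between `D^ϱ` and its right adjoint. -/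
def lockDagAdj {q r : L} (ϱ : q ⟶ r) :
    CategoryTheory.Adjunction (P.context.lock (FreeDagger.ofHom ϱ)) (P.lockDag ϱ) :=
  P.hat.lockAdj (FreeDagger.dagAdj ϱ trivial)

/-- The pseudonaturality isomorphism of the reflectors. -/
def lockDagReflector {q r : L} (ϱ : q ⟶ r) :
    P.lockDag ϱ ⋙ P.reflector ⟨r⟩ ≅ P.reflector ⟨q⟩ ⋙ P.push (FreeDagger.ofHom ϱ) :=
  Cat.Hom.toNatIso (P.refl.naturality ϱ)

instance (p : FreeDagger S) : PreservesFiniteLimits (P.reflector p) :=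
  P.preservesFiniteLimits p.as

theorem hasFiniteLimits (p : FreeDagger S) : HasFiniteLimits (P.context.Ctx p) :=
  (P.isLocallyCartesianClosed ⟨p.as⟩).hasFiniteLimits

/-- The right adjoint of the reflector. -/
def inclusion (p : FreeDagger S) : P.preModel.functor.obj p ⥤ P.context.Ctx p := P.incl p.as

/-- The adjunction between the reflector and its right adjoint. -/
def reflectorAdj (p : FreeDagger S) :
    CategoryTheory.Adjunction (P.reflector p) (P.inclusion p) :=
  P.adj p.as

instance (p : FreeDagger S) : (P.inclusion p).Full := P.full_incl p.as
instance (p : FreeDagger S) : (P.inclusion p).Faithful := P.faithful_incl p.as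

/-- The reflection onto `C_p`. -/
noncomputable def reflectorLift (p : L) :
    RightAdjointOver (P.reflector ⟨p⟩) (P.reflector ⟨p⟩) (𝟭 _) :=
  .ofReflective (P.reflectorAdj ⟨p⟩)

theorem reflectorLift_unit_app (p : L) (Γ : P.context.Ctx ⟨p⟩) :
    (P.reflectorLift p).unit.app Γ = 𝟙 _ :=
  RightAdjointOver.ofReflective_unit_app (P.reflectorAdj ⟨p⟩) Γ

/-- The right adjoint of `L_p ∘ D^μ` over `C_μ`. -/
abbrev PushLift {p q : FreeDagger S} (μ : p ⟶ q) :=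
  RightAdjointOver (P.context.lock μ ⋙ P.reflector p) (P.reflector q) (P.push μ)

/-- The case of a morphism in `L`. -/
noncomputable def pushLiftOfHom {q r : L} (ϱ : q ⟶ r) :
    P.PushLift (FreeDagger.ofHom ϱ : (⟨q⟩ : FreeDagger S) ⟶ ⟨r⟩) :=
  -- The same construction as in `liftComp`, started from the reflection itself, so that the two
  -- units can be compared.
  ((P.reflectorLift q).comp (P.lockDagAdj ϱ) (P.lockDagReflector ϱ)).congr
    (Iso.refl _) (Functor.leftUnitor _)

/-- The case of the right adjoint of a morphism in `S`. -/
noncomputable def pushLiftDag {p q : L} (ν : p ⟶ q) (h : S ν) :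
    P.PushLift (FreeDagger.dag ν h : (⟨q⟩ : FreeDagger S) ⟶ ⟨p⟩) :=
  -- Pseudonaturality identifies L ∘ D^(ν†) with C_ν ∘ L, and C_ν is left adjoint to C_(ν†) because
  -- pseudofunctors preserve adjunctions.
  (RightAdjointOver.ofReflectiveComp (P.reflectorAdj ⟨p⟩)
    (CategoryTheory.Adjunction.ofCat (P.preModel.functor.mapAdjunction
      (FreeDagger.dagAdj ν h)))).congr (P.lockDagReflector ν).symm (Iso.refl _)

/-- The composite of a morphism with a morphism in `L`. -/
noncomputable def liftComp {p : FreeDagger S} {q r : L} {μ : p ⟶ ⟨q⟩} (X : P.PushLift μ)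
    (ϱ : q ⟶ r) :
    RightAdjointOver (P.context.lock (μ ≫ FreeDagger.ofHom ϱ) ⋙ P.reflector p) (P.reflector ⟨r⟩)
      (P.push μ ⋙ P.push (FreeDagger.ofHom ϱ)) :=
  (X.comp (P.lockDagAdj ϱ) (P.lockDagReflector ϱ)).congr
    ((Functor.associator _ _ _).symm ≪≫
      Functor.isoWhiskerRight (P.context.lockComp μ (FreeDagger.ofHom ϱ)).symm _) (Iso.refl _)

/-- Both units pass through the unit of D^ϱ ⊣ D^(ϱ†) and the pseudonaturality isomorphism, and the
reflection contributes an identity. Comparison maps therefore compose, which is what makes the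
squares for μ, ϱ and their composite fit together. -/
theorem liftComp_unit_app {p : FreeDagger S} {q r : L} {μ : p ⟶ ⟨q⟩} (X : P.PushLift μ)
    (ϱ : q ⟶ r) (Γ : P.context.Ctx ⟨r⟩) :
    (P.liftComp X ϱ).unit.app Γ = (P.pushLiftOfHom ϱ).unit.app Γ ≫
      (P.push (FreeDagger.ofHom ϱ)).map (X.unit.app _ ≫ (P.push μ).map ((P.reflector p).map
        ((P.context.lockComp μ (FreeDagger.ofHom ϱ)).inv.app Γ))) := by
  rw [liftComp, RightAdjointOver.congr_unit_app, RightAdjointOver.comp_unit_app, pushLiftOfHom,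
    RightAdjointOver.congr_unit_app, RightAdjointOver.comp_unit_app,
    reflectorLift_unit_app]
  simp

/-- The two shapes of a sharp morphism are handled by `pushLiftOfHom` and by `liftComp` applied to
`pushLiftDag`; the rest is transport along an isomorphism of 1-cells. -/
theorem nonempty_pushLift {p q : FreeDagger S} (μ : p ⟶ q) (hμ : FreeDagger.IsSharp μ) :
    Nonempty (P.PushLift μ) := by
  have key : ∀ {μ μ' : p ⟶ q}, (μ ≅ μ') → P.PushLift μ' → P.PushLift μ := fun e X =>
    X.congr (Functor.isoWhiskerRight (P.context.lockIso e.symm) _)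
      (Cat.Hom.toNatIso (P.preModel.functor.map₂Iso e.symm))
  rcases hμ with ⟨m, ⟨e⟩⟩ | ⟨s, ν, h, m, ⟨e⟩⟩
  · exact ⟨key e (P.pushLiftOfHom m)⟩
  · exact ⟨key e ((P.liftComp (P.pushLiftDag ν h) m).congr (Iso.refl _)
      (Cat.Hom.toNatIso (P.preModel.functor.mapComp _ _)).symm)⟩

theorem isAdjointModalNaturalModel_splitting :
    P.splitting.IsAdjointModalNaturalModel (FreeDagger.modeTheory S) := by
  intro p q μ hμ
  obtain ⟨X⟩ := P.nonempty_pushLift μ hμ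
  have := P.hasFiniteLimits q
  exact (P.preModel.model p).representable_whiskerLeft X.adj

end AdjointModalPreModel

/-! ### Positive modalities from natural formation and introduction rules -/

namespace TypeFamily

universe t

variable {K : Type u} [Bicategory.{w, v} K] {D : ModalContextStructure.{w, v, u, v', u'} K}
  {T : TypeFamily.{w, v, u, t, v', u'} D} [Bicategory.Strict K] {M : AdjointModeTheory K}
  (c : T.ComprehensionChoice M) {p q : K} {μ : p ⟶ q} (hμ : M.tangible μ)

section

variable (F : T.TyL μ ⟶ T.Ty q) (m : T.TmL μ ⟶ T.Tm q) (w : m ≫ T.τ q = T.τL μ ≫ F)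

include w in
theorem τ_app_of_comm {Γ : D.Ctx q} {A : (T.TyL μ).obj (op Γ)} (a : (T.TmL μ).obj (op Γ))
    (ha : (T.τL μ).app (op Γ) a = A) : (T.τ q).app (op Γ) (m.app (op Γ) a) = F.app (op Γ) A := by
  rw [← ha]
  exact congrArg (fun f => f.app (op Γ) a) w

/-- The formation structure determined by natural formation and introduction rules. -/
noncomputable def formationOfNat : PositiveFormation T M c μ hμ where
  F A := F.app _ A
  F_subst σ A := NatTrans.naturality_apply F σ.op A
  j A := (c.plain (F.app _ A)).lift (c.compr μ hμ A).p (m.app _ (c.compr μ hμ A).q)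
    ((τ_app_of_comm F m w _ (c.compr μ hμ A).q_type).trans (NatTrans.naturality_apply F _ A))
  j_p A := Comprehension.lift_p _ _ _ _
  j_subst σ A := by
    refine Comprehension.hom_ext _ ?_ ?_
    · rw [Category.assoc, Comprehension.map_p, ← Category.assoc, Comprehension.lift_p,
        Category.assoc, Comprehension.lift_p, Comprehension.map_p]
    · rw [op_comp, Functor.map_comp_apply, Comprehension.map_q, Comprehension.lift_q, op_comp,
        Functor.map_comp_apply, Comprehension.lift_q, ← NatTrans.naturality_apply,
        Comprehension.map_q]

/-- The generic term pulled back along the section named by `a` is `a` itself, so naturality of `m`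
recovers `m` from its value on generic terms. -/
theorem formationOfNat_mod {Γ : D.Ctx q} (A : (T.TyL μ).obj (op Γ)) (a : (T.TmL μ).obj (op Γ))
    (ha : (T.τL μ).app (op Γ) a = A) : (formationOfNat c hμ F m w).mod A a ha = m.app _ a := by
  rw [PositiveFormation.mod, op_comp, Functor.map_comp_apply, formationOfNat,
    Comprehension.lift_q, ← NatTrans.naturality_apply, Comprehension.lift_q]

end

/-! ### Compatibility of the introduction rule and of ℓ with substitution -/

namespace PositiveFormation

variable {c hμ} (Φ : PositiveFormation T M c μ hμ)

/-- `j_subst` moves the substitution across `j`; what remains are two maps from `Ξ` to `Γ ▷_μ A`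
with the same projection and the same term. -/
theorem mod_subst {Ξ Γ : D.Ctx q} (σ : Ξ ⟶ Γ) (A : (T.TyL μ).obj (op Γ))
    (a : (T.TmL μ).obj (op Γ)) (ha : (T.τL μ).app (op Γ) a = A)
    (ha' : (T.τL μ).app (op Ξ) ((T.TmL μ).map σ.op a) = (T.TyL μ).map σ.op A) :
    Φ.mod ((T.TyL μ).map σ.op A) ((T.TmL μ).map σ.op a) ha' =
      (T.Tm q).map σ.op (Φ.mod A a ha) := by
  have h := (Comprehension.map_q (c.plain (Φ.F ((T.TyL μ).map σ.op A))) (c.plain (Φ.F A)) σ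
    (Φ.F_subst σ A)).symm
  rw [mod, mod, h, ← Functor.map_comp_apply, ← Functor.map_comp_apply, ← op_comp, ← op_comp,
    Category.assoc, Φ.j_subst, ← Category.assoc, ← Category.assoc]
  refine congrArg (fun f => (T.Tm q).map (f ≫ Φ.j A).op (c.plain (Φ.F A)).q) ?_
  refine Comprehension.hom_ext _ ?_ ?_
  · rw [Category.assoc, Category.assoc, Comprehension.map_p, ← Category.assoc,
      Comprehension.lift_p, Comprehension.lift_p, Category.id_comp, Category.comp_id]
  · rw [op_comp, Functor.map_comp_apply, Comprehension.map_q, Comprehension.lift_q, op_comp,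
      Functor.map_comp_apply, Comprehension.lift_q]

variable {r : K} (ϱ : q ⟶ r) (hϱ : M.tangible ϱ) (hμϱ : M.tangible (μ ≫ ϱ))

section

variable {Γ : D.Ctx r} (A : (T.TyL (μ ≫ ϱ)).obj (op Γ))

/-- The term `ℓ` of `F_μ A` in context `Γ ▷_(ϱ ∘ μ) A`. -/
noncomputable def ellTerm : (T.TmL ϱ).obj (op (c.compr (μ ≫ ϱ) hμϱ A).ext) :=
  Φ.mod (T.splitTy μ ϱ ((T.TyL (μ ≫ ϱ)).map (c.compr (μ ≫ ϱ) hμϱ A).p.op A))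
    (T.splitTm μ ϱ (c.compr (μ ≫ ϱ) hμϱ A).q)
    ((T.τL_splitTm μ ϱ _).trans (congrArg _ (c.compr (μ ≫ ϱ) hμϱ A).q_type))

theorem τ_ellTerm : (T.τL ϱ).app _ (Φ.ellTerm ϱ hμϱ A) =
    (T.TyL ϱ).map (c.compr (μ ≫ ϱ) hμϱ A).p.op (Φ.F (T.splitTy μ ϱ A)) :=
  (Φ.τ_mod _ _ _).trans (Φ.F_splitTy_subst ϱ _ A)

theorem ell_p : Φ.ell ϱ hϱ hμϱ A ≫ (c.compr ϱ hϱ (Γ := Γ) (Φ.F (T.splitTy μ ϱ A))).p =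
    (c.compr (μ ≫ ϱ) hμϱ A).p :=
  Comprehension.lift_p _ _ _ (Φ.τ_ellTerm ϱ hμϱ A)

theorem map_ell_q : (T.TmL ϱ).map (Φ.ell ϱ hϱ hμϱ A).op
      (c.compr ϱ hϱ (Γ := Γ) (Φ.F (T.splitTy μ ϱ A))).q = Φ.ellTerm ϱ hμϱ A :=
  Comprehension.lift_q _ _ _ (Φ.τ_ellTerm ϱ hμϱ A)

end

theorem splitTm_subst {Ξ Γ : D.Ctx r} (σ : Ξ ⟶ Γ) (a : (T.TmL (μ ≫ ϱ)).obj (op Γ)) :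
    T.splitTm μ ϱ ((T.TmL (μ ≫ ϱ)).map σ.op a) =
      (T.TmL μ).map ((D.lock ϱ).map σ).op (T.splitTm μ ϱ a) := by
  have h' := congrArg (fun f => (T.Tm p).map f.op a) ((D.lockComp μ ϱ).inv.naturality σ)
  simp only [op_comp, Functor.map_comp_apply] at h'
  exact h'.symm

theorem mod_congr {Γ : D.Ctx q} {A A' : (T.TyL μ).obj (op Γ)} {a a' : (T.TmL μ).obj (op Γ)}
    (ha : (T.τL μ).app (op Γ) a = A) (ha' : (T.τL μ).app (op Γ) a' = A') (h : a = a') :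
    Φ.mod A a ha = Φ.mod A' a' ha' := by
  subst ha ha' h; rfl

/-- Maps into a comprehension are compared by projections and generic terms; for the terms this is
`mod_subst` in contexts of the form `(D.lock ϱ).obj _`. -/
theorem ell_naturality {Ξ Γ : D.Ctx r} (σ : Ξ ⟶ Γ) {A : (T.TyL (μ ≫ ϱ)).obj (op Γ)}
    {A' : (T.TyL (μ ≫ ϱ)).obj (op Ξ)} (h : A' = (T.TyL (μ ≫ ϱ)).map σ.op A)
    (h' : Φ.F (T.splitTy μ ϱ A') = (T.TyL ϱ).map σ.op (Φ.F (T.splitTy μ ϱ A))) :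
    Φ.ell ϱ hϱ hμϱ A' ≫
        Comprehension.map (c.compr ϱ hϱ (Γ := Ξ) (Φ.F (T.splitTy μ ϱ A')))
          (c.compr ϱ hϱ (Γ := Γ) (Φ.F (T.splitTy μ ϱ A))) σ h' =
      Comprehension.map (c.compr (μ ≫ ϱ) hμϱ A') (c.compr (μ ≫ ϱ) hμϱ A) σ h ≫
        Φ.ell ϱ hϱ hμϱ A := by
  refine Comprehension.hom_ext _ ?_ ?_
  · rw [Category.assoc, Comprehension.map_p, ← Category.assoc, Category.assoc _ (Φ.ell ϱ hϱ hμϱ A),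
      ell_p, ell_p, Comprehension.map_p]
  · rw [op_comp, Functor.map_comp_apply, Comprehension.map_q, op_comp, Functor.map_comp_apply,
      map_ell_q, map_ell_q]
    have hs : (T.τL μ).app _ ((T.TmL μ).map ((D.lock ϱ).map (Comprehension.map
        (c.compr (μ ≫ ϱ) hμϱ A') (c.compr (μ ≫ ϱ) hμϱ A) σ h)).op
          (T.splitTm μ ϱ (c.compr (μ ≫ ϱ) hμϱ A).q)) = _ :=
      (NatTrans.naturality_apply (T.τL μ) _ _).trans
        (congrArg _ ((T.τL_splitTm μ ϱ _).trans (congrArg _ (c.compr (μ ≫ ϱ) hμϱ A).q_type)))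
    refine Eq.trans ?_ (Φ.mod_subst ((D.lock ϱ).map _) _ _ _ hs)
    refine Φ.mod_congr _ _ ?_
    rw [← splitTm_subst, Comprehension.map_q]

end PositiveFormation

end TypeFamily

/-! ### Positive modalities of the splitting -/

/-- Commutativity of the upper square in `isPullback_ell`, in abstract form: `h` is supplied by
`generic_ell` and `h'` by naturality of the comparison map. -/
theorem comp_map_map_comp_map {C C' C'' : Type*} [Category C] [Category C'] [Category C'']
    {M : C ⥤ C'} {R : C' ⥤ C''} {a b : C''} {d d' e : C'} {j k l : C} {x : a ⟶ b}
    {y : b ⟶ R.obj d'} {y' : a ⟶ R.obj d} {z : d ⟶ d'} {w : d' ⟶ e} {n : d ⟶ M.obj j} {m : j ⟶ k}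
    {g : k ⟶ l} {i : M.obj l ⟶ e} (h : z ≫ w = n ≫ M.map (m ≫ g) ≫ i)
    (h' : x ≫ y = y' ≫ R.map z) :
    ((y' ≫ R.map (n ≫ M.map m)) ≫ (M ⋙ R).map g) ≫ R.map i = x ≫ y ≫ R.map w := by
  rw [← Category.assoc x, h', Category.assoc y' _ (R.map w), ← R.map_comp, h]
  simp

namespace AdjointModalPreModel

variable {L : Type u} [Bicategory.{w, v} L] [Bicategory.Strict L] {S : MorphismClass L}
  (P : AdjointModalPreModel.{w, v, u, t₁, t₂, v', u'} S)

/-- The functor `L_p ∘ D^μ`. -/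
abbrev lockReflector {p q : FreeDagger S} (μ : p ⟶ q) :
    P.context.Ctx q ⥤ P.preModel.functor.obj p :=
  P.context.lock μ ⋙ P.reflector p

/-! ### Generic terms of the modal comprehensions -/

section generic

variable {p q : FreeDagger S} {μ : p ⟶ q} {Γ : P.context.Ctx q}
  {A : (P.preModel.model p).SplitTy ((P.lockReflector μ).obj Γ)}
  (X : Comprehension (P.splitting.τL μ) (Γ := Γ) A)

/-- The morphism underlying the generic term of `Γ ▷_μ A`. -/
noncomputable def generic :
    (P.lockReflector μ).obj X.ext ⟶ ((P.preModel.model p).compr A.type).ext :=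
  NaturalPseudoModel.genericTerm (G := P.lockReflector μ) (N := P.preModel.model p) X

theorem q_eq_generic : X.q = (⟨A.base, A.type, P.generic X⟩ :
    (P.preModel.model p).SplitTm ((P.lockReflector μ).obj X.ext)) :=
  NaturalPseudoModel.q_eq_genericTerm (G := P.lockReflector μ) (N := P.preModel.model p) X

theorem map_q_eq_iff_generic {Ξ : P.context.Ctx q} (f : Ξ ⟶ X.ext)
    (x : (P.lockReflector μ).obj Ξ ⟶ ((P.preModel.model p).compr A.type).ext) :
    (P.splitting.TmL μ).map f.op X.q = (⟨A.base, A.type, x⟩ :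
      (P.preModel.model p).SplitTm ((P.lockReflector μ).obj Ξ)) ↔
      (P.lockReflector μ).map f ≫ P.generic X = x :=
  NaturalPseudoModel.map_q_eq_iff (G := P.lockReflector μ) (N := P.preModel.model p) X f x

theorem isPullback_generic {C' : Type*} [Category C'] {K : P.context.Ctx q ⥤ C'}
    {M : P.preModel.functor.obj p ⥤ C'} [PreservesFiniteLimits K]
    (Y : RightAdjointOver (P.lockReflector μ) K M) :
    IsPullback (Y.unit.app X.ext ≫ M.map (P.generic X)) (K.map X.p)
      (M.map ((P.preModel.model p).compr A.type).p) (Y.unit.app Γ ≫ M.map A.name) :=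
  NaturalPseudoModel.isPullback_unit (N := P.preModel.model p) Y X

end generic

/-! ### Formation and introduction rules from pre-modalities -/

/-- The data of a positive pre-modality: the types `F♭` and the maps `i`. -/
structure PrePositive {p q : FreeDagger S} (μ : p ⟶ q) where
  lift : P.PushLift μ
  F {V : P.preModel.functor.obj p} (E : (P.preModel.model p).Ty.obj ⟨op V⟩) :
    (P.preModel.model q).Ty.obj ⟨op ((P.push μ).obj V)⟩
  i {V : P.preModel.functor.obj p} (E : (P.preModel.model p).Ty.obj ⟨op V⟩) :
    (P.push μ).obj ((P.preModel.model p).compr E).ext ⟶ ((P.preModel.model q).compr (F E)).ext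
  i_p {V : P.preModel.functor.obj p} (E : (P.preModel.model p).Ty.obj ⟨op V⟩) :
    i E ≫ ((P.preModel.model q).compr (F E)).p =
      (P.push μ).map ((P.preModel.model p).compr E).p

namespace PrePositive

variable {P} {p q : FreeDagger S} {μ : p ⟶ q} (X : P.PrePositive μ)

/-- The formation rule. -/
def ty : P.splitting.TyL μ ⟶ P.splitting.Ty q where
  app Γ := ↾fun (A : (P.preModel.model p).SplitTy ((P.lockReflector μ).obj Γ.unop)) =>
    (⟨(P.push μ).obj A.base, X.F A.type, X.lift.unit.app Γ.unop ≫ (P.push μ).map A.name⟩ :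
      (P.preModel.model q).SplitTy ((P.reflector q).obj Γ.unop))
  naturality Γ Ξ σ := by
    ext (A : (P.preModel.model p).SplitTy ((P.lockReflector μ).obj Γ.unop))
    -- The local universe and the type over it do not depend on the context, so strict naturality
    -- concerns only the names, where it is naturality of the comparison map.
    refine congrArg (NaturalPseudoModel.SplitTy.mk ((P.push μ).obj A.base) (X.F A.type)) ?_
    refine Eq.trans ?_ (X.lift.unit_naturality_assoc σ.unop _).symm
    exact congrArg _ ((P.push μ).map_comp _ _)

/-- The introduction rule. -/
def tm : P.splitting.TmL μ ⟶ P.splitting.Tm q where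
  app Γ := ↾fun (a : (P.preModel.model p).SplitTm ((P.lockReflector μ).obj Γ.unop)) =>
    (⟨(P.push μ).obj a.base, X.F a.type,
      X.lift.unit.app Γ.unop ≫ (P.push μ).map a.term ≫ X.i a.type⟩ :
      (P.preModel.model q).SplitTm ((P.reflector q).obj Γ.unop))
  naturality Γ Ξ σ := by
    ext (a : (P.preModel.model p).SplitTm ((P.lockReflector μ).obj Γ.unop))
    refine congrArg (NaturalPseudoModel.SplitTm.mk ((P.push μ).obj a.base) (X.F a.type)) ?_
    refine Eq.trans ?_ (X.lift.unit_naturality_assoc σ.unop _).symm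
    refine congrArg (_ ≫ ·) ?_
    exact (congrArg (· ≫ _) ((P.push μ).map_comp _ _)).trans (Category.assoc _ _ _)

theorem tm_τ : X.tm ≫ P.splitting.τ q = P.splitting.τL μ ≫ X.ty := by
  ext Γ (a : (P.preModel.model p).SplitTm ((P.lockReflector μ).obj Γ.unop))
  refine congrArg (NaturalPseudoModel.SplitTy.mk ((P.push μ).obj a.base) (X.F a.type)) ?_
  refine (Category.assoc _ _ _).trans (congrArg (_ ≫ ·) ((Category.assoc _ _ _).trans ?_))
  exact (congrArg (_ ≫ ·) (X.i_p _)).trans ((P.push μ).map_comp _ _).symm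

variable (c : P.splitting.ComprehensionChoice (FreeDagger.modeTheory S))
  (hμ : (FreeDagger.modeTheory S).tangible μ)

/-- The formation structure. -/
noncomputable def formation :
    P.splitting.PositiveFormation (FreeDagger.modeTheory S) c μ hμ :=
  TypeFamily.formationOfNat c hμ X.ty X.tm X.tm_τ

theorem formation_mod {Γ : P.context.Ctx q} (A : (P.splitting.TyL μ).obj (op Γ))
    (a : (P.splitting.TmL μ).obj (op Γ)) (ha : (P.splitting.τL μ).app (op Γ) a = A) :
    (X.formation c hμ).mod A a ha = X.tm.app _ a :=
  TypeFamily.formationOfNat_mod c hμ _ _ _ A a ha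

end PrePositive

/-! ### The reflection of ℓ as a pullback of a stably anodyne map -/

section elimination

variable {P} {p : FreeDagger S} {q r : L} {μ : p ⟶ (⟨q⟩ : FreeDagger S)} (X : P.PrePositive μ)
  (c : P.splitting.ComprehensionChoice (FreeDagger.modeTheory S))
  (hμ : (FreeDagger.modeTheory S).tangible μ) (ϱ : q ⟶ r)
  (hϱ : (FreeDagger.modeTheory S).tangible (FreeDagger.ofHom ϱ : (⟨q⟩ : FreeDagger S) ⟶ ⟨r⟩))
  (hμϱ : (FreeDagger.modeTheory S).tangible (μ ≫ FreeDagger.ofHom ϱ))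

/-- The comprehension `Γ ▷_(ϱ ∘ μ) A`. -/
noncomputable abbrev domCompr {Γ : P.context.Ctx ⟨r⟩}
    (A : (P.splitting.TyL (μ ≫ FreeDagger.ofHom ϱ)).obj (op Γ)) :=
  c.compr (μ ≫ FreeDagger.ofHom ϱ) hμϱ A

/-- The comprehension `Γ ▷_ϱ (F_μ A)`. -/
noncomputable abbrev codCompr {Γ : P.context.Ctx ⟨r⟩}
    (A : (P.splitting.TyL (μ ≫ FreeDagger.ofHom ϱ)).obj (op Γ)) :=
  c.compr (FreeDagger.ofHom ϱ) hϱ (Γ := Γ) ((X.formation c hμ).F (P.splitting.splitTy μ _ A))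

/-- By construction ℓ pulls the generic term of its target back to `X.tm` applied to that of its
source; the right-hand side is the unfolding of `X.tm`. -/
theorem PrePositive.generic_ell {Γ : P.context.Ctx ⟨r⟩}
    (A : (P.preModel.model p).SplitTy ((P.lockReflector (μ ≫ FreeDagger.ofHom ϱ)).obj Γ)) :
    (P.lockReflector (FreeDagger.ofHom ϱ)).map ((X.formation c hμ).ell _ hϱ hμϱ (Γ := Γ) A) ≫
        P.generic (A := X.ty.app (op ((P.context.lock (FreeDagger.ofHom ϱ)).obj Γ))
          (P.splitting.splitTy μ _ A))
          (codCompr X c hμ ϱ hϱ (Γ := Γ) A) =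
      X.lift.unit.app
          ((P.context.lock (FreeDagger.ofHom ϱ)).obj (domCompr c ϱ hμϱ (Γ := Γ) A).ext) ≫
        (P.push μ).map
          ((P.reflector p).map ((P.context.lockComp μ (FreeDagger.ofHom ϱ)).inv.app _) ≫
            P.generic (domCompr c ϱ hμϱ (Γ := Γ) A)) ≫ X.i A.type := by
  refine (P.map_q_eq_iff_generic _ _ _).1 ?_
  refine ((X.formation c hμ).map_ell_q _ hϱ hμϱ _).trans ?_
  refine (X.formation_mod c hμ _ _ _).trans ?_
  exact congrArg (fun a => X.tm.app _ (P.splitting.splitTm μ (FreeDagger.ofHom ϱ) a))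
    (P.q_eq_generic (domCompr c ϱ hμϱ (Γ := Γ) A))

/-- The target of ℓ is a pullback of C_ϱ(p_(F♭E)), and its source one of C_ϱ C_μ(p_E), which factors
through the former as C_ϱ(i) followed by the projection. Cancelling the lower square leaves the
asserted one. -/
theorem PrePositive.isPullback_ell {Γ : P.context.Ctx ⟨r⟩}
    (A : (P.preModel.model p).SplitTy ((P.lockReflector (μ ≫ FreeDagger.ofHom ϱ)).obj Γ)) :
    IsPullback
      ((P.liftComp X.lift ϱ).unit.app _ ≫ (P.push μ ⋙ P.push (FreeDagger.ofHom ϱ)).map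
        (P.generic (domCompr c ϱ hμϱ (Γ := Γ) A)))
      ((P.reflector ⟨r⟩).map ((X.formation c hμ).ell _ hϱ hμϱ (Γ := Γ) A))
      ((P.push (FreeDagger.ofHom ϱ)).map (X.i A.type))
      ((P.pushLiftOfHom ϱ).unit.app _ ≫ (P.push (FreeDagger.ofHom ϱ)).map
        (P.generic (A := X.ty.app (op ((P.context.lock (FreeDagger.ofHom ϱ)).obj Γ))
          (P.splitting.splitTy μ _ A))
          (codCompr X c hμ ϱ hϱ (Γ := Γ) A))) := by
  have : PreservesFiniteLimits (P.reflector ⟨r⟩) := P.preservesFiniteLimits r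
  have h₁ := P.isPullback_generic (domCompr c ϱ hμϱ (Γ := Γ) A) (P.liftComp X.lift ϱ)
  have h₂ := P.isPullback_generic (A := X.ty.app (op ((P.context.lock (FreeDagger.ofHom ϱ)).obj Γ))
    (P.splitting.splitTy μ _ A)) (codCompr X c hμ ϱ hϱ (Γ := Γ) A) (P.pushLiftOfHom ϱ)
  have e₁ : (P.reflector ⟨r⟩).map ((X.formation c hμ).ell _ hϱ hμϱ (Γ := Γ) A) ≫
      (P.reflector ⟨r⟩).map (codCompr X c hμ ϱ hϱ (Γ := Γ) A).p =
        (P.reflector ⟨r⟩).map (domCompr c ϱ hμϱ (Γ := Γ) A).p :=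
    ((P.reflector ⟨r⟩).map_comp _ _).symm.trans
      (congrArg _ ((X.formation c hμ).ell_p _ hϱ hμϱ (Γ := Γ) A))
  have e₂ : (P.push (FreeDagger.ofHom ϱ)).map (X.i A.type) ≫
      (P.push (FreeDagger.ofHom ϱ)).map ((P.preModel.model ⟨q⟩).compr (X.F A.type)).p =
        (P.push μ ⋙ P.push (FreeDagger.ofHom ϱ)).map ((P.preModel.model p).compr A.type).p := by
    rw [← Functor.map_comp, X.i_p]; rfl
  -- The names at the bottom of the two pullbacks agree because comparison maps compose.
  have e₃ : (P.pushLiftOfHom ϱ).unit.app Γ ≫ (P.push (FreeDagger.ofHom ϱ)).map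
      (X.lift.unit.app _ ≫ (P.push μ).map ((P.reflector p).map
        ((P.context.lockComp μ (FreeDagger.ofHom ϱ)).inv.app Γ) ≫ A.name)) =
      (P.liftComp X.lift ϱ).unit.app Γ ≫
        (P.push μ ⋙ P.push (FreeDagger.ofHom ϱ)).map A.name := by
    rw [P.liftComp_unit_app, Functor.comp_map, Category.assoc, ← Functor.map_comp,
      Category.assoc, ← Functor.map_comp]
  refine IsPullback.of_bot (v₂₁ := (P.reflector ⟨r⟩).map (codCompr X c hμ ϱ hϱ (Γ := Γ) A).p)
    (v₂₂ := (P.push (FreeDagger.ofHom ϱ)).map ((P.preModel.model ⟨q⟩).compr (X.F A.type)).p)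
    (h₃₁ := (P.pushLiftOfHom ϱ).unit.app Γ ≫ (P.push (FreeDagger.ofHom ϱ)).map
      (X.lift.unit.app _ ≫ (P.push μ).map ((P.reflector p).map
        ((P.context.lockComp μ (FreeDagger.ofHom ϱ)).inv.app Γ) ≫ A.name))) ?_ ?_ h₂
  · rw [e₁, e₂, e₃]
    exact h₁
  · rw [P.liftComp_unit_app]
    exact comp_map_map_comp_map (M := P.push μ) (R := P.push (FreeDagger.ofHom ϱ))
      (X.generic_ell c hμ ϱ hϱ hμϱ A)
      ((P.pushLiftOfHom ϱ).unit_naturality ((X.formation c hμ).ell _ hϱ hμϱ (Γ := Γ) A))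

end elimination

end AdjointModalPreModel

/-! ### Natural choice of fillers in the reflections -/

namespace AdjointModalPreModel

variable {L : Type u} [Bicategory.{w, v} L] [Bicategory.Strict L] {S : MorphismClass L}
  (P : AdjointModalPreModel.{w, v, u, t₁, t₂, v', u'} S)

/-- The type with a given local universe and name. -/
def namedTy {p q : FreeDagger S} {μ : p ⟶ q} {V : P.preModel.functor.obj p}
    (E : (P.preModel.model p).Ty.obj ⟨op V⟩) {Γ : P.context.Ctx q}
    (n : (P.lockReflector μ).obj Γ ⟶ V) : (P.splitting.TyL μ).obj (op Γ) :=
  (⟨V, E, n⟩ : (P.preModel.model p).SplitTy ((P.lockReflector μ).obj Γ))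

theorem namedTy_eq_iff {p q : FreeDagger S} {μ : p ⟶ q} {V : P.preModel.functor.obj p}
    (E : (P.preModel.model p).Ty.obj ⟨op V⟩) {Ξ Γ : P.context.Ctx q} (σ : Ξ ⟶ Γ)
    (n' : (P.lockReflector μ).obj Ξ ⟶ V) (n : (P.lockReflector μ).obj Γ ⟶ V) :
    P.namedTy E n' = (P.splitting.TyL μ).map σ.op (P.namedTy E n) ↔
      n' = (P.lockReflector μ).map σ ≫ n := by
  constructor
  · intro h
    have h' : (⟨V, E, n'⟩ : (P.preModel.model p).SplitTy ((P.lockReflector μ).obj Ξ)) =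
      ⟨V, E, (P.lockReflector μ).map σ ≫ n⟩ := h
    simpa using h'
  · rintro rfl
    rfl

variable {P} {p : FreeDagger S} {q r : L} {μ : p ⟶ (⟨q⟩ : FreeDagger S)} (X : P.PrePositive μ)
  (c : P.splitting.ComprehensionChoice (FreeDagger.modeTheory S))
  (hμ : (FreeDagger.modeTheory S).tangible μ) (ϱ : q ⟶ r)
  (hϱ : (FreeDagger.modeTheory S).tangible (FreeDagger.ofHom ϱ : (⟨q⟩ : FreeDagger S) ⟶ ⟨r⟩))
  (hμϱ : (FreeDagger.modeTheory S).tangible (μ ≫ FreeDagger.ofHom ϱ))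

section functors

variable {V : P.preModel.functor.obj p} (E : (P.preModel.model p).Ty.obj ⟨op V⟩)

/-- The functor from contexts with a name to slices over the context that classifies names. -/
noncomputable abbrev namesToOver := costructuredArrowToOver (P.liftComp X.lift ϱ).adj V

/-- The right adjoint evaluated at `V` is a context carrying a universal name, the counit; every
other name is obtained from it by substitution along its transpose. -/
theorem namedTy_hom (O : CostructuredArrow (P.lockReflector (μ ≫ FreeDagger.ofHom ϱ)) V) :
    P.namedTy E O.hom = (P.splitting.TyL _).map ((namesToOver X ϱ).obj O).hom.op
      (P.namedTy E ((P.liftComp X.lift ϱ).adj.counit.app V)) := by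
  refine (P.namedTy_eq_iff E _ _ _).2 ?_
  refine Eq.trans ?_ ((P.liftComp X.lift ϱ).adj.homEquiv_counit _ _ _)
  exact (Equiv.symm_apply_apply _ _).symm

/-- Strict naturality of formation carries the universal instance of `namedTy_hom` over to the
targets of ℓ. -/
theorem formation_namedTy_hom
    (O : CostructuredArrow (P.lockReflector (μ ≫ FreeDagger.ofHom ϱ)) V) :
    (X.formation c hμ).F (P.splitting.splitTy μ _ (P.namedTy E O.hom)) =
      (P.splitting.TyL (FreeDagger.ofHom ϱ)).map ((namesToOver X ϱ).obj O).hom.op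
        ((X.formation c hμ).F (P.splitting.splitTy μ (FreeDagger.ofHom ϱ)
          (P.namedTy E ((P.liftComp X.lift ϱ).adj.counit.app V)))) :=
  (congrArg (fun A => (X.formation c hμ).F (P.splitting.splitTy μ _ A))
    (namedTy_hom X ϱ E O)).trans ((X.formation c hμ).F_splitTy_subst _ _ _)

/-- The comprehensions `Γ ▷_(ϱ ∘ μ) A`, as a functor of a context `Γ` with a name for `A`. -/
noncomputable def domFunctor :
    CostructuredArrow (P.lockReflector (μ ≫ FreeDagger.ofHom ϱ)) V ⥤ P.context.Ctx ⟨r⟩ :=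
  Comprehension.extFunctor (namesToOver X ϱ) _ (fun O => P.namedTy E O.hom)
    (namedTy_hom X ϱ E) (fun O => domCompr c ϱ hμϱ (P.namedTy E O.hom))

/-- The comprehensions `Γ ▷_ϱ (F_μ A)`, as a functor of a context `Γ` with a name for `A`. -/
noncomputable def codFunctor :
    CostructuredArrow (P.lockReflector (μ ≫ FreeDagger.ofHom ϱ)) V ⥤ P.context.Ctx ⟨r⟩ :=
  Comprehension.extFunctor (τ := P.splitting.τL (FreeDagger.ofHom ϱ)) (namesToOver X ϱ)
    _ (fun O => (X.formation c hμ).F (P.splitting.splitTy μ _ (P.namedTy E O.hom)))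
    (formation_namedTy_hom X c hμ ϱ E)
    (fun O => codCompr X c hμ ϱ hϱ (P.namedTy E O.hom))

/-- The maps `ℓ` as a natural transformation. -/
noncomputable def ellNat : domFunctor X c ϱ hμϱ E ⟶ codFunctor X c hμ ϱ hϱ E where
  app O := (X.formation c hμ).ell _ hϱ hμϱ (P.namedTy E O.hom)
  naturality _ _ f := ((X.formation c hμ).ell_naturality _ hϱ hμϱ f.left
    (Comprehension.type_naturality (namesToOver X ϱ) _ (fun O => P.namedTy E O.hom)
      (namedTy_hom X ϱ E) f)
    (Comprehension.type_naturality (Ty := P.splitting.TyL (FreeDagger.ofHom ϱ)) (namesToOver X ϱ) _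
      (fun O => (X.formation c hμ).F (P.splitting.splitTy μ _ (P.namedTy E O.hom)))
      (formation_namedTy_hom X c hμ ϱ E) f)).symm

theorem isLeftAdjoint_domFunctor : (domFunctor X c ϱ hμϱ E).IsLeftAdjoint :=
  have := P.hasFiniteLimits ⟨r⟩
  Comprehension.isLeftAdjoint_extFunctor _ _ _ _ _
    (P.isLocallyCartesianClosed ⟨r⟩).isLeftAdjoint (domCompr c ϱ hμϱ _)

theorem isLeftAdjoint_codFunctor : (codFunctor X c hμ ϱ hϱ E).IsLeftAdjoint :=
  have := P.hasFiniteLimits ⟨r⟩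
  Comprehension.isLeftAdjoint_extFunctor _ _ _ _ _
    (P.isLocallyCartesianClosed ⟨r⟩).isLeftAdjoint (codCompr X c hμ ϱ hϱ _)

end functors

variable (hX : ∀ {V : P.preModel.functor.obj p} (E : (P.preModel.model p).Ty.obj ⟨op V⟩),
  (P.preModel.model ⟨r⟩).StablyAnodyne ((P.push (FreeDagger.ofHom ϱ)).map (X.i E)))

include hX in
-- With `E` and `E'` fixed, the source and target of the reflected ℓ are left adjoint functors of
-- the named context, so `exists_natural_fillers` applies. Fixing them is harmless, as substitution
-- alters only names.
theorem exists_natural_eliminators {V : P.preModel.functor.obj p}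
    (E : (P.preModel.model p).Ty.obj ⟨op V⟩) {V' : P.preModel.functor.obj ⟨r⟩}
    (E' : (P.preModel.model ⟨r⟩).Ty.obj ⟨op V'⟩) :
    ∃ fill : ∀ {Γ : P.context.Ctx ⟨r⟩}
        (n : (P.lockReflector (μ ≫ FreeDagger.ofHom ϱ)).obj Γ ⟶ V)
        (b : (P.reflector ⟨r⟩).obj (codCompr X c hμ ϱ hϱ (P.namedTy E n)).ext ⟶ V')
        (g : (P.reflector ⟨r⟩).obj (domCompr c ϱ hμϱ (P.namedTy E n)).ext ⟶
          ((P.preModel.model ⟨r⟩).compr E').ext),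
        g ≫ ((P.preModel.model ⟨r⟩).compr E').p =
          (P.reflector ⟨r⟩).map ((X.formation c hμ).ell _ hϱ hμϱ (P.namedTy E n)) ≫ b →
        ((P.reflector ⟨r⟩).obj (codCompr X c hμ ϱ hϱ (P.namedTy E n)).ext ⟶
          ((P.preModel.model ⟨r⟩).compr E').ext),
      (∀ {Γ : P.context.Ctx ⟨r⟩} (n : (P.lockReflector (μ ≫ FreeDagger.ofHom ϱ)).obj Γ ⟶ V) b g e,
        fill n b g e ≫ ((P.preModel.model ⟨r⟩).compr E').p = b ∧
        (P.reflector ⟨r⟩).map ((X.formation c hμ).ell _ hϱ hμϱ (P.namedTy E n)) ≫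
          fill n b g e = g) ∧
      ∀ {Ξ Γ : P.context.Ctx ⟨r⟩} (σ : Ξ ⟶ Γ)
        (n : (P.lockReflector (μ ≫ FreeDagger.ofHom ϱ)).obj Γ ⟶ V)
        (n' : (P.lockReflector (μ ≫ FreeDagger.ofHom ϱ)).obj Ξ ⟶ V)
        (hn : P.namedTy E n' = (P.splitting.TyL _).map σ.op (P.namedTy E n))
        (hn' : (X.formation c hμ).F (P.splitting.splitTy μ _ (P.namedTy E n')) =
          (P.splitting.TyL (FreeDagger.ofHom ϱ)).map σ.op
            ((X.formation c hμ).F (P.splitting.splitTy μ _ (P.namedTy E n)))) b g e b' g' e',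
        b' = (P.reflector ⟨r⟩).map (Comprehension.map (codCompr X c hμ ϱ hϱ (P.namedTy E n'))
          (codCompr X c hμ ϱ hϱ (P.namedTy E n)) σ hn') ≫ b →
        g' = (P.reflector ⟨r⟩).map (Comprehension.map (domCompr c ϱ hμϱ (P.namedTy E n'))
          (domCompr c ϱ hμϱ (P.namedTy E n)) σ hn) ≫ g →
        fill n' b' g' e' = (P.reflector ⟨r⟩).map (Comprehension.map
          (codCompr X c hμ ϱ hϱ (P.namedTy E n')) (codCompr X c hμ ϱ hϱ (P.namedTy E n)) σ hn') ≫
            fill n b g e := by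
  have := P.hasFiniteLimits ⟨r⟩
  have := isLeftAdjoint_domFunctor X c ϱ hμϱ E
  have := isLeftAdjoint_codFunctor X c hμ ϱ hϱ E
  have : (P.reflector ⟨r⟩).IsLeftAdjoint := ⟨_, ⟨P.reflectorAdj ⟨r⟩⟩⟩
  have := hasPullbacks_costructuredArrow V (P.liftComp X.lift ϱ).adj
  obtain ⟨fill, h₁, h₂⟩ := exists_natural_fillers
    (domFunctor X c ϱ hμϱ E ⋙ P.reflector ⟨r⟩) (codFunctor X c hμ ϱ hϱ E ⋙ P.reflector ⟨r⟩)
    (Functor.whiskerRight (ellNat X c hμ ϱ hϱ hμϱ E) _) ((P.preModel.model ⟨r⟩).compr E').p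
    -- The reflected ℓ is a pullback of the stably anodyne map for `E`, hence has fillers against
    -- every type projection.
    (fun O b g e => (hX E).exists_filler (X.isPullback_ell c hμ ϱ hϱ hμϱ ⟨V, E, O.hom⟩) E' b g e)
  refine ⟨fun n => fill (CostructuredArrow.mk n), fun n => h₁ (CostructuredArrow.mk n), ?_⟩
  intro Ξ Γ σ n n' hn hn' b g e b' g' e' hb hg
  -- A substitution compatible with the names is precisely a morphism of the comma category on which
  -- the fillers are natural.
  exact h₂ (CostructuredArrow.homMk (f := CostructuredArrow.mk n') (f' := CostructuredArrow.mk n) σ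
    ((P.namedTy_eq_iff E σ n' n).1 hn).symm) b g e b' g' e' hb hg

end AdjointModalPreModel

/-! ### Sections of plain comprehensions, and the elimination rule -/

namespace AdjointModalPreModel

variable {L : Type u} [Bicategory.{w, v} L] [Bicategory.Strict L] {S : MorphismClass L}
  {P : AdjointModalPreModel.{w, v, u, t₁, t₂, v', u'} S}

section plain

variable {r : FreeDagger S} {Γ : P.context.Ctx r}
  {B : (P.preModel.model r).SplitTy ((P.reflector r).obj Γ)}
  (Y : Comprehension (P.splitting.τ r) (Γ := Γ) B)

/-- The morphism underlying the generic term of `Γ ▷ B`. -/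
noncomputable def plainGeneric :
    (P.reflector r).obj Y.ext ⟶ ((P.preModel.model r).compr B.type).ext :=
  NaturalPseudoModel.genericTerm (G := P.reflector r) (N := P.preModel.model r) Y

theorem plainGeneric_p : plainGeneric Y ≫ ((P.preModel.model r).compr B.type).p =
    (P.reflector r).map Y.p ≫ B.name :=
  NaturalPseudoModel.genericTerm_p (G := P.reflector r) (N := P.preModel.model r) Y

theorem plain_hom_ext {Ξ : P.context.Ctx r} {f g : Ξ ⟶ Y.ext} (hp : f ≫ Y.p = g ≫ Y.p)
    (hq : (P.reflector r).map f ≫ plainGeneric Y = (P.reflector r).map g ≫ plainGeneric Y) :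
    f = g :=
  NaturalPseudoModel.comprehension_hom_ext (G := P.reflector r) (N := P.preModel.model r) Y hp hq

/-- This turns a filler constructed after reflection into a section of `Γ ▷ B`; `plain_hom_ext`
shows that the section is determined by the filler. -/
theorem exists_plain_section (x : (P.reflector r).obj Γ ⟶ ((P.preModel.model r).compr B.type).ext)
    (h : x ≫ ((P.preModel.model r).compr B.type).p = B.name) :
    ∃ f : Γ ⟶ Y.ext, f ≫ Y.p = 𝟙 Γ ∧ (P.reflector r).map f ≫ plainGeneric Y = x :=
  (NaturalPseudoModel.existsUnique_lift (G := P.reflector r) (N := P.preModel.model r) Y (𝟙 Γ) x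
    (by rw [h, CategoryTheory.Functor.map_id, Category.id_comp])).exists

theorem map_plainGeneric {Ξ : P.context.Ctx r} (σ : Ξ ⟶ Γ)
    (Y' : Comprehension (P.splitting.τ r) (Γ := Ξ) ((P.splitting.Ty r).map σ.op B)) :
    (P.reflector r).map (Comprehension.map Y' Y σ rfl) ≫ plainGeneric Y =
      plainGeneric (B := ⟨B.base, B.type, (P.reflector r).map σ ≫ B.name⟩) Y' :=
  (NaturalPseudoModel.map_q_eq_iff (G := P.reflector r) (N := P.preModel.model r) Y _ _).1
    ((Comprehension.map_q Y' Y σ rfl).trans (NaturalPseudoModel.q_eq_genericTerm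
      (A := ⟨B.base, B.type, (P.reflector r).map σ ≫ B.name⟩) (G := P.reflector r)
      (N := P.preModel.model r) Y'))

end plain

/-- The eliminator is the section whose generic term is the natural filler of the reflected square.
Each required equation between maps into `Γ ▷ B` then splits into one of projections and one of
generic terms, the latter already known for fillers. -/
theorem nonempty_positiveElimination {p : FreeDagger S} {q r : L} {μ : p ⟶ (⟨q⟩ : FreeDagger S)}
    (X : P.PrePositive μ) (c : P.splitting.ComprehensionChoice (FreeDagger.modeTheory S))
    (hμ : (FreeDagger.modeTheory S).tangible μ) (ϱ : q ⟶ r)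
    (hϱ : (FreeDagger.modeTheory S).tangible (FreeDagger.ofHom ϱ : (⟨q⟩ : FreeDagger S) ⟶ ⟨r⟩))
    (hμϱ : (FreeDagger.modeTheory S).tangible (μ ≫ FreeDagger.ofHom ϱ))
    (hX : ∀ {V : P.preModel.functor.obj p} (E : (P.preModel.model p).Ty.obj ⟨op V⟩),
      (P.preModel.model ⟨r⟩).StablyAnodyne ((P.push (FreeDagger.ofHom ϱ)).map (X.i E))) :
    Nonempty (P.splitting.PositiveElimination (FreeDagger.modeTheory S) (X.formation c hμ)
      (FreeDagger.ofHom ϱ) hϱ hμϱ) := by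
  -- The choice is indexed by local universes and types over them, never by contexts, so a
  -- substituted problem uses the same `fill`.
  choose fill hfill hnat using fun (V : P.preModel.functor.obj p)
    (E : (P.preModel.model p).Ty.obj ⟨op V⟩) (V' : P.preModel.functor.obj ⟨r⟩)
    (E' : (P.preModel.model ⟨r⟩).Ty.obj ⟨op V'⟩) =>
    exists_natural_eliminators X c hμ ϱ hϱ hμϱ hX E E'
  have hg' : ∀ {Γ : P.context.Ctx ⟨r⟩}
      (A : (P.preModel.model p).SplitTy ((P.lockReflector (μ ≫ FreeDagger.ofHom ϱ)).obj Γ))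
      (B : (P.preModel.model ⟨r⟩).SplitTy ((P.reflector ⟨r⟩).obj
        (codCompr X c hμ ϱ hϱ (Γ := Γ) A).ext))
      (g : (domCompr c ϱ hμϱ (Γ := Γ) A).ext ⟶ (c.plain (p := ⟨r⟩) B).ext)
      (_ : g ≫ (c.plain (p := ⟨r⟩) B).p = (X.formation c hμ).ell _ hϱ hμϱ (Γ := Γ) A),
      ((P.reflector ⟨r⟩).map g ≫ plainGeneric (c.plain (p := ⟨r⟩) B)) ≫
        ((P.preModel.model ⟨r⟩).compr B.type).p =
      (P.reflector ⟨r⟩).map ((X.formation c hμ).ell _ hϱ hμϱ (Γ := Γ) A) ≫ B.name := by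
    intro Γ A B g hg
    rw [Category.assoc, plainGeneric_p, ← Category.assoc, ← Functor.map_comp, hg]
  have key : ∀ {Γ : P.context.Ctx ⟨r⟩}
      (A : (P.preModel.model p).SplitTy ((P.lockReflector (μ ≫ FreeDagger.ofHom ϱ)).obj Γ))
      (B : (P.preModel.model ⟨r⟩).SplitTy ((P.reflector ⟨r⟩).obj
        (codCompr X c hμ ϱ hϱ (Γ := Γ) A).ext))
      (g : (domCompr c ϱ hμϱ (Γ := Γ) A).ext ⟶ (c.plain (p := ⟨r⟩) B).ext)
      (hg : g ≫ (c.plain (p := ⟨r⟩) B).p = (X.formation c hμ).ell _ hϱ hμϱ (Γ := Γ) A),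
      ∃ h : (codCompr X c hμ ϱ hϱ (Γ := Γ) A).ext ⟶ (c.plain (p := ⟨r⟩) B).ext,
        h ≫ (c.plain (p := ⟨r⟩) B).p = 𝟙 _ ∧
        (P.reflector ⟨r⟩).map h ≫ plainGeneric (c.plain (p := ⟨r⟩) B) =
          fill A.base A.type B.base B.type A.name B.name _ (hg' A B g hg) :=
    fun {Γ} A B g hg => exists_plain_section (c.plain (p := ⟨r⟩) B) _
      (hfill A.base A.type B.base B.type A.name B.name _ (hg' A B g hg)).1
  choose elim helim_p helim using @key
  refine ⟨⟨fun {Γ} A B g hg => elim A B g hg, fun {Γ} A B g hg => helim_p A B g hg,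
    fun {Γ} A B g hg => ?_, fun {Ξ Γ} σ A B g hg => ?_⟩⟩
  · refine plain_hom_ext (c.plain (p := ⟨r⟩) B) ?_ ?_
    · exact (Category.assoc _ _ _).trans ((congrArg (_ ≫ ·) (helim_p A B g hg)).trans
        ((Category.comp_id _).trans hg.symm))
    · rw [Functor.map_comp]
      exact (Category.assoc _ _ _).trans ((congrArg (_ ≫ ·) (helim A B g hg)).trans
        (hfill _ _ _ _ _ _ _ (hg' A B g hg)).2)
  · intro Aσ m n Bσ k gσ hgσ hk
    -- Since `Bσ` has the same universe and type as `B`, their generic terms land in the same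
    -- comprehension and differ only by `k`.
    have hkB : (P.reflector ⟨r⟩).map k ≫ plainGeneric (c.plain (p := ⟨r⟩) B) =
      plainGeneric (c.plain (p := ⟨r⟩) Bσ) := map_plainGeneric (c.plain (p := ⟨r⟩) B) m _
    refine plain_hom_ext (c.plain (p := ⟨r⟩) B) ?_ ?_
    · refine (Category.assoc _ _ _).trans ((congrArg (_ ≫ ·)
        (Comprehension.map_p _ (c.plain (p := ⟨r⟩) B) m rfl)).trans ?_)
      refine (Category.assoc _ _ _).symm.trans ((congrArg (· ≫ m)
        (helim_p Aσ Bσ gσ hgσ)).trans ((Category.id_comp _).trans ?_))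
      exact ((Category.assoc _ _ _).trans ((congrArg (m ≫ ·) (helim_p A B g hg)).trans
        (Category.comp_id _))).symm
    · rw [Functor.map_comp, Functor.map_comp]
      refine (Category.assoc _ _ _).trans ((congrArg (_ ≫ ·) hkB).trans
        ((helim Aσ Bσ gσ hgσ).trans ?_))
      refine Eq.trans ?_ ((Category.assoc _ _ _).trans
        (congrArg (_ ≫ ·) (helim A B g hg))).symm
      -- The names of the substituted types are restrictions by definition, hence `rfl`; only
      -- compatibility of the tops `gσ` and `g` is left, and it follows from `hk`.
      refine hnat _ _ _ _ σ _ _ rfl _ _ _ _ _ _ _ rfl ?_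
      refine (congrArg (_ ≫ ·) hkB.symm).trans ((Category.assoc _ _ _).symm.trans ?_)
      refine Eq.trans ?_ (Category.assoc _ _ _)
      refine congrArg (· ≫ plainGeneric (c.plain (p := ⟨r⟩) B)) ?_
      exact ((P.reflector ⟨r⟩).map_comp _ _).symm.trans
        ((congrArg _ hk).trans ((P.reflector ⟨r⟩).map_comp _ _))

theorem hasPositiveModalities_splitting
    (hP : P.preModel.HasPositivePreModalities (FreeDagger.modeTheory S))
    (c : P.splitting.ComprehensionChoice (FreeDagger.modeTheory S)) :
    P.splitting.HasPositiveModalities (FreeDagger.modeTheory S) c := by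
  rintro p ⟨q⟩ μ hμ
  -- One choice for each type over each object of the pre-model, independent of the contexts named
  -- into it.
  choose F i hi hX using fun (V : P.preModel.functor.obj p)
    (E : (P.preModel.model p).Ty.obj ⟨op V⟩) => hP μ hμ V E
  obtain ⟨Y⟩ := P.nonempty_pushLift μ hμ
  let X : P.PrePositive μ := ⟨Y, fun {V} E => F V E, fun {V} E => i V E, fun {V} E => hi V E⟩
  have helim : ∀ {r : FreeDagger S} (ϱ : (⟨q⟩ : FreeDagger S) ⟶ r)
      (hϱ : (FreeDagger.modeTheory S).transparent ϱ),
      Nonempty (P.splitting.PositiveElimination (FreeDagger.modeTheory S)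
        (X.formation c ((FreeDagger.modeTheory S).tangible_of_sharp hμ)) ϱ
        ((FreeDagger.modeTheory S).tangible_of_transparent hϱ)
        ((FreeDagger.modeTheory S).tangible_comp hμ hϱ)) := by
    rintro ⟨r⟩ ϱ hϱ
    -- The `id` keeps `hϱ` available, since the goal and `hX` still refer to it.
    obtain ⟨ϱ, rfl⟩ := id hϱ
    exact nonempty_positiveElimination X c _ ϱ _ _ (fun {V} E => hX V E _ hϱ)
  exact ⟨⟨X.formation c _, fun ϱ hϱ => (helim ϱ hϱ).some⟩⟩

end AdjointModalPreModel

end MATT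

theorem mainTheorem5 {L : Type u} [CategoryTheory.Bicategory.{w, v} L]
    [CategoryTheory.Bicategory.Strict L] (S : MATT.MorphismClass L)
    (P : MATT.AdjointModalPreModel.{w, v, u, t₁, t₂, v', u'} S)
    (hP : P.preModel.HasPositivePreModalities (MATT.FreeDagger.modeTheory S)) :
    P.splitting.IsAdjointModalNaturalModel (MATT.FreeDagger.modeTheory S) ∧
      ∀ c : P.splitting.ComprehensionChoice (MATT.FreeDagger.modeTheory S),
        P.splitting.HasPositiveModalities (MATT.FreeDagger.modeTheory S) c :=
  ⟨P.isAdjointModalNaturalModel_splitting,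
    fun c => MATT.AdjointModalPreModel.hasPositiveModalities_splitting hP c⟩
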